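/- For $c\in\mathbb R$ and $z\ge 0$ let $e_c(z)=\frac{c}{\sqrt\pi}\int_0^z e^{-t^2/4}\,dt$. For $\delta>0$ and $\sigma\ge0$ consider the following boundary value problem on $[0,\infty)$ for a pair $(\phi,\psi)$ of real functions that are twice continuously differentiable up to $z=0$: $$\begin{cases} (1-\delta+\phi+e_\delta)^2\phi''+\frac z2(1-\delta+\phi+e_\delta)\phi'+(1-\delta+\phi+e_\delta)(-\delta+\phi+e_\delta)e_\delta''-\frac z2(\psi+e_\sigma)(\psi'+e_\sigma')\\ \qquad=(1-\delta+\phi+e_\delta)\big[(\psi'+e_\sigma')^2-(\phi'+e_\delta')^2\big],\\ (1-\delta+\phi+e_\delta)^2\psi''+\frac z2(1-\delta+\phi+e_\delta)\psi'-\frac z2(e_\sigma+\psi)(\phi'+e_\delta')+(1-\delta+\phi+e_\delta)(-\delta+\phi+e_\delta)e_\sigma''=0,\\ \phi(0)=\psi(0)=0,\qquad \lim_{z\to\infty}\phi(z)=\lim_{z\to\infty}\psi(z)=0. \end{cases}$$ All norms below are over $z\in(0,\infty)$; the square of an $L^2$-type norm of several functions is the sum of the squares. Put $$\|f\|_{H^2_w}^2=\|f''\|_{L^2}^2+\|(1+z)f'\|_{L^2}^2+\|(1+z)f\|_{L^2}^2,\qquad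 \|f\|_{H^k}^2=\sum_{j=0}^k\|\partial_z^jf\|_{L^2}^2,$$ and, for $l,m,k\in\mathbb N=\{0,1,2,\dots\}$, $$R_l(\delta,\sigma)=\max\big\{\|e_\sigma\|_{L^\infty},\ \|z^l(e_\delta-\delta)\|_{L^\infty},\ \|z^le_\delta'\|_{L^\infty},\ \|z^le_\sigma'\|_{L^\infty},\ \|z^l(e_\delta',e_\sigma',e_\delta'',e_\sigma'')\|_{L^2}\big\},$$ $$R(\delta,\sigma;m,k)=\max\big\{\tfrac\sigma2,\ \|z^m\partial_z^k(e_\delta-\delta)\|_{L^2}\big\}.$$ **Lemma.** There are $\varepsilon>0$, a constant $C$ and constants $K_{m,k}$ $(m,k\in\mathbb N)$ such that for all $0<\delta<\varepsilon$ and $0\le\sigma<\varepsilon$ the boundary value problem has exactly one solution $(\phi,\psi)$ on $[0,\infty)$. This solution is infinitely differentiable on $[0,\infty)$, and it satisfies $$\|(\phi,\psi)\|_{H^2_w}\le C\,R_l(\delta,\sigma)\quad\text{for every } l\in\mathbb N,$$ $$\|z^m(\phi,\psi)\|_{H^k}\le K_{m,k}\,R(\delta,\sigma;m,k)\quad\text{for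 all } m,k\in\mathbb N.$$ The constants $\varepsilon, C, K_{m,k}$ do not depend on $\delta,\sigma$. -/

import Mathlib

open Set Filter Topology MeasureTheory
open scoped NNReal ENNReal

noncomputable section

namespace SelfSimilarProfile

/-- `k`-th derivative of a function on the closed half-line `[0, ∞)` (one-sided at `0`). -/
def hderiv (k : ℕ) (f : ℝ → ℝ) : ℝ → ℝ :=
  iteratedDerivWithin k f (Ici 0)

/-- The `L^p` norm on `(0, ∞)`, with values in `[0, ∞]`. -/
def hnorm (p : ℝ≥0∞) (f : ℝ → ℝ) : ℝ≥0∞ :=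
  eLpNorm f p (volume.restrict (Ici 0))

/-- The Gaussian front `e_c(z) = (c / √π) ∫₀ᶻ exp(-t² / 4) dt`. -/
def front (c z : ℝ) : ℝ :=
  c / Real.sqrt Real.pi * ∫ t in (0 : ℝ)..z, Real.exp (-t ^ 2 / 4)

/-- The boundary value problem for the self-similar profiles `(φ, ψ)` on `[0, ∞)`, for classical
(twice continuously differentiable up to the boundary) solutions. -/
structure IsSolution (δ σ : ℝ) (φ ψ : ℝ → ℝ) : Prop where
  regular_fst : ContDiffOn ℝ 2 φ (Ici 0)
  regular_snd : ContDiffOn ℝ 2 ψ (Ici 0)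
  eq_fst : ∀ z : ℝ, 0 ≤ z →
    (1 - δ + φ z + front δ z) ^ 2 * hderiv 2 φ z
      + z / 2 * (1 - δ + φ z + front δ z) * hderiv 1 φ z
      + (1 - δ + φ z + front δ z) * (-δ + φ z + front δ z) * hderiv 2 (front δ) z
      - z / 2 * (ψ z + front σ z) * (hderiv 1 ψ z + hderiv 1 (front σ) z)
    = (1 - δ + φ z + front δ z) *
        ((hderiv 1 ψ z + hderiv 1 (front σ) z) ^ 2 - (hderiv 1 φ z + hderiv 1 (front δ) z) ^ 2)
  eq_snd : ∀ z : ℝ, 0 ≤ z →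
    (1 - δ + φ z + front δ z) ^ 2 * hderiv 2 ψ z
      + z / 2 * (1 - δ + φ z + front δ z) * hderiv 1 ψ z
      - z / 2 * (front σ z + ψ z) * (hderiv 1 φ z + hderiv 1 (front δ) z)
      + (1 - δ + φ z + front δ z) * (-δ + φ z + front δ z) * hderiv 2 (front σ) z
    = 0
  zero_fst : φ 0 = 0
  zero_snd : ψ 0 = 0
  infty_fst : Tendsto φ atTop (𝓝 0)
  infty_snd : Tendsto ψ atTop (𝓝 0)

/-- `‖f‖²` for the weighted norm `H²_w`. -/
def hwSq (f : ℝ → ℝ) : ℝ≥0∞ :=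
  hnorm 2 (hderiv 2 f) ^ 2
    + hnorm 2 (fun z => (1 + z) * hderiv 1 f z) ^ 2
    + hnorm 2 (fun z => (1 + z) * f z) ^ 2

/-- The `H²_w` norm of a pair. -/
def hwNorm (φ ψ : ℝ → ℝ) : ℝ≥0∞ :=
  (hwSq φ + hwSq ψ) ^ (1 / 2 : ℝ)

/-- The `H^k(0, ∞)` norm of a pair of functions that are `C^k` on `[0, ∞)`. -/
def sobolevNorm (k : ℕ) (f g : ℝ → ℝ) : ℝ≥0∞ :=
  (∑ j ∈ Finset.range (k + 1),
    (hnorm 2 (hderiv j f) ^ 2 + hnorm 2 (hderiv j g) ^ 2)) ^ (1 / 2 : ℝ)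

/-- `R(δ, σ)`, the size of the Gaussian fronts, formed with the weight `z ^ l`. -/
def frontSize (l : ℕ) (δ σ : ℝ) : ℝ≥0∞ :=
  max (max (hnorm ⊤ (front σ)) (hnorm ⊤ (fun z => z ^ l * (front δ z - δ))))
    (max
      (max (hnorm ⊤ (fun z => z ^ l * hderiv 1 (front δ) z))
        (hnorm ⊤ (fun z => z ^ l * hderiv 1 (front σ) z)))
      ((hnorm 2 (fun z => z ^ l * hderiv 1 (front δ) z) ^ 2
        + hnorm 2 (fun z => z ^ l * hderiv 1 (front σ) z) ^ 2
        + hnorm 2 (fun z => z ^ l * hderiv 2 (front δ) z) ^ 2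
        + hnorm 2 (fun z => z ^ l * hderiv 2 (front σ) z) ^ 2) ^ (1 / 2 : ℝ)))

/-- `R(δ, σ; m, k) = max {σ / 2, ‖z^m ∂_z^k (e_δ - δ)‖_{L²}}`. -/
def frontSizeAt (m k : ℕ) (δ σ : ℝ) : ℝ≥0∞ :=
  max (ENNReal.ofReal (σ / 2))
    (hnorm 2 (fun z => z ^ m * hderiv k (fun y => front δ y - δ) z))

end SelfSimilarProfile

end

namespace SelfSimilarProfile

/-! ### One-sided derivatives and the Gaussian front -/

/-! Put u = 1 - δ + φ + e_δ and v = ψ + e_σ. The identity e_c'' = -(z/2) e_c' absorbs the explicit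
front terms, and the sum and difference of the two equations become equations for p = u + v and q =
u - v in which p' solves the linear homogeneous equation f' = -`drift` f, with a coefficient
depending on p, q, q'; the same holds for q' with p and q exchanged. Hence p' is the multiple of
`decayFactor` = exp(-∫ `drift`) whose integral is P - a, where a = 1 - δ and P = 1 + σ; likewise for
q' with Q = 1 - σ. Near p = q = 1 the drift is about z/2, so this factor decays like a Gaussian.

Existence: (p', q') is a fixed point in a space weighted by exp(-z²/8). The map has Lipschitz
constant proportional to |P - a| and |Q - a|, so it contracts for small δ, σ
(`abs_normalizedDecay_sub_le_half`, `exists_isFixedPair`).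

Uniqueness concerns all classical solutions, for which neither smallness nor u > 0 is known
beforehand. `IsCharPair.add_pos` excludes zeros of u by examining the last one. Then p' and q' keep
their signs, so p and q stay between their end values, and every solution falls in the contraction
regime (`IsCharPair.nearOne`, `IsCharPair.isFixedPair`).

Estimates: the fixed point is O(δ + σ) times a Gaussian, and differentiating the equations shows
that every derivative has this size and decays rapidly (`derivBound_rapid_of_isCharPair`). So every
norm of (φ, ψ) in the theorem is O(δ + σ). The fronts are linear in their amplitudes, so R_l and
R(m, k) in turn dominate δ + σ (`exists_le_frontSize`, `exists_le_frontSizeAt`). -/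

/-- The derivative of the Gaussian front. -/
noncomputable def frontDeriv (c z : ℝ) : ℝ :=
  c / Real.sqrt Real.pi * Real.exp (-z ^ 2 / 4)

theorem hasDerivAt_front (c z : ℝ) : HasDerivAt (front c) (frontDeriv c z) z := by
  have hc : Continuous fun t : ℝ => Real.exp (-t ^ 2 / 4) := by fun_prop
  exact (intervalIntegral.integral_hasDerivAt_right (hc.intervalIntegrable _ _)
    hc.stronglyMeasurable.stronglyMeasurableAtFilter hc.continuousAt).const_mul _

theorem hasDerivAt_frontDeriv (c z : ℝ) :
    HasDerivAt (frontDeriv c) (-(z / 2) * frontDeriv c z) z := by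
  have h : HasDerivAt (fun z : ℝ => -z ^ 2 / 4) (-(z / 2)) z := by
    have := ((hasDerivAt_pow 2 z).neg).div_const 4
    refine this.congr_deriv ?_
    push_cast
    ring
  have := (h.exp).const_mul (c / Real.sqrt Real.pi)
  refine this.congr_deriv ?_
  unfold frontDeriv
  ring

theorem front_zero (c : ℝ) : front c 0 = 0 := by simp [front]

theorem tendsto_front (c : ℝ) : Tendsto (front c) atTop (𝓝 c) := by
  have hi : IntegrableOn (fun t : ℝ => Real.exp (-(1 / 4) * t ^ 2)) (Ioi 0) :=
    (integrable_exp_neg_mul_sq (by norm_num)).integrableOn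
  have h := intervalIntegral_tendsto_integral_Ioi 0 hi tendsto_id
  rw [integral_gaussian_Ioi] at h
  have h2 := h.const_mul (c / Real.sqrt Real.pi)
  have hpi : Real.sqrt Real.pi ≠ 0 := (Real.sqrt_pos.2 Real.pi_pos).ne'
  have h4 : Real.sqrt (Real.pi / (1 / 4)) / 2 = Real.sqrt Real.pi := by
    rw [show Real.pi / (1 / 4) = Real.pi * 2 ^ 2 by ring, Real.sqrt_mul Real.pi_pos.le,
      Real.sqrt_sq (by norm_num)]
    ring
  rw [h4, div_mul_cancel₀ _ hpi] at h2
  refine h2.congr fun z => ?_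
  unfold front
  congr 2
  ext t
  congr 1
  ring

theorem hderiv_zero (f : ℝ → ℝ) : hderiv 0 f = f := by
  ext z; simp [hderiv]

theorem hderiv_congr {f g : ℝ → ℝ} (h : EqOn f g (Ici 0)) (k : ℕ) :
    EqOn (hderiv k f) (hderiv k g) (Ici 0) :=
  iteratedDerivWithin_congr h

theorem hderiv_succ_of_hasDerivWithinAt {f f' : ℝ → ℝ}
    (h : ∀ z, 0 ≤ z → HasDerivWithinAt f (f' z) (Ici 0) z) (k : ℕ) :
    EqOn (hderiv (k + 1) f) (hderiv k f') (Ici 0) := by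
  intro z hz
  have h1 : EqOn (derivWithin f (Ici 0)) f' (Ici 0) := fun y hy =>
    (h y hy).derivWithin (uniqueDiffOn_Ici 0 y hy)
  calc hderiv (k + 1) f z = hderiv k (derivWithin f (Ici 0)) z := by
        simp only [hderiv, iteratedDerivWithin_succ']
    _ = _ := hderiv_congr h1 k hz

theorem hderiv_one_of_hasDerivWithinAt {f f' : ℝ → ℝ}
    (h : ∀ z, 0 ≤ z → HasDerivWithinAt f (f' z) (Ici 0) z) {z : ℝ} (hz : 0 ≤ z) :
    hderiv 1 f z = f' z := by
  have := hderiv_succ_of_hasDerivWithinAt h 0 (mem_Ici.2 hz)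
  rwa [hderiv_zero] at this

theorem hderiv_two_of_hasDerivWithinAt {f f' f'' : ℝ → ℝ}
    (h : ∀ z, 0 ≤ z → HasDerivWithinAt f (f' z) (Ici 0) z)
    (h' : ∀ z, 0 ≤ z → HasDerivWithinAt f' (f'' z) (Ici 0) z) {z : ℝ} (hz : 0 ≤ z) :
    hderiv 2 f z = f'' z := by
  rw [hderiv_succ_of_hasDerivWithinAt h 1 (mem_Ici.2 hz), hderiv_one_of_hasDerivWithinAt h' hz]

theorem hasDerivWithinAt_hderiv {f : ℝ → ℝ} {n : WithTop ℕ∞} (hf : ContDiffOn ℝ n f (Ici 0))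
    {k : ℕ} (hk : (k : WithTop ℕ∞) < n) {z : ℝ} (hz : 0 ≤ z) :
    HasDerivWithinAt (hderiv k f) (hderiv (k + 1) f z) (Ici 0) z := by
  have := (hf.differentiableOn_iteratedDerivWithin hk (uniqueDiffOn_Ici 0) z hz).hasDerivWithinAt
  simpa only [hderiv, iteratedDerivWithin_succ] using this

theorem hderiv_one_front (c : ℝ) {z : ℝ} (hz : 0 ≤ z) :
    hderiv 1 (front c) z = frontDeriv c z :=
  hderiv_one_of_hasDerivWithinAt (fun y _ => (hasDerivAt_front c y).hasDerivWithinAt) hz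

theorem hderiv_two_front (c : ℝ) {z : ℝ} (hz : 0 ≤ z) :
    hderiv 2 (front c) z = -(z / 2) * frontDeriv c z :=
  hderiv_two_of_hasDerivWithinAt (fun y _ => (hasDerivAt_front c y).hasDerivWithinAt)
    (fun y _ => (hasDerivAt_frontDeriv c y).hasDerivWithinAt) hz

theorem contDiffOn_succ_of_hasDerivWithinAt {f f' : ℝ → ℝ} {n : ℕ}
    (h : ∀ z, 0 ≤ z → HasDerivWithinAt f (f' z) (Ici 0) z) (h' : ContDiffOn ℝ n f' (Ici 0)) :
    ContDiffOn ℝ (n + 1 : ℕ) f (Ici 0) := by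
  have h1 : EqOn (derivWithin f (Ici 0)) f' (Ici 0) := fun y hy =>
    (h y hy).derivWithin (uniqueDiffOn_Ici 0 y hy)
  push_cast
  rw [contDiffOn_succ_iff_derivWithin (uniqueDiffOn_Ici 0)]
  exact ⟨fun z hz => (h z hz).differentiableWithinAt, by simp, h'.congr h1⟩

/-! ### The characteristic variables `p = u + v`, `q = u - v` -/

/-- The boundary value problem in the characteristic variables `p = u + v` and `q = u - v`, where
`u = 1 - δ + φ + e_δ` and `v = ψ + e_σ`; here `f` and `g` are the derivatives of `p` and `q`. -/
structure IsCharPair (a P Q : ℝ) (p q f g : ℝ → ℝ) : Prop where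
  deriv_fst : ∀ z, 0 ≤ z → HasDerivWithinAt p (f z) (Ici 0) z
  deriv_snd : ∀ z, 0 ≤ z → HasDerivWithinAt q (g z) (Ici 0) z
  ode_fst : ∀ z, 0 ≤ z → ∃ f', HasDerivWithinAt f f' (Ici 0) z ∧
    ((p z + q z) / 2) ^ 2 * f' + (p z + q z) / 2 * (f z * g z) + z / 2 * (q z * f z) = 0
  ode_snd : ∀ z, 0 ≤ z → ∃ g', HasDerivWithinAt g g' (Ici 0) z ∧
    ((p z + q z) / 2) ^ 2 * g' + (p z + q z) / 2 * (f z * g z) + z / 2 * (p z * g z) = 0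
  init_fst : p 0 = a
  init_snd : q 0 = a
  lim_fst : Tendsto p atTop (𝓝 P)
  lim_snd : Tendsto q atTop (𝓝 Q)

/-- The coefficient of the linear equation `f' = - drift * f` satisfied by `f = p'`. -/
noncomputable def drift (p q g : ℝ → ℝ) (z : ℝ) : ℝ :=
  2 * g z / (p z + q z) + 2 * z * q z / (p z + q z) ^ 2

theorem continuousOn_drift {p q g : ℝ → ℝ} {S : Set ℝ} (hp : ContinuousOn p S)
    (hq : ContinuousOn q S) (hg : ContinuousOn g S)
    (hs : ∀ z ∈ S, 0 < p z + q z) : ContinuousOn (drift p q g) S :=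
  ((continuousOn_const.mul hg).div (hp.add hq) fun z hz => (hs z hz).ne').add
    (((continuousOn_const.mul continuousOn_id).mul hq).div ((hp.add hq).pow 2)
      fun z hz => (pow_pos (hs z hz) 2).ne')

namespace IsCharPair

variable {a P Q : ℝ} {p q f g : ℝ → ℝ}

theorem swap (h : IsCharPair a P Q p q f g) : IsCharPair a Q P q p g f where
  deriv_fst := h.deriv_snd
  deriv_snd := h.deriv_fst
  ode_fst z hz := by
    obtain ⟨g', h1, h2⟩ := h.ode_snd z hz
    exact ⟨g', h1, by linear_combination h2⟩
  ode_snd z hz := by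
    obtain ⟨g', h1, h2⟩ := h.ode_fst z hz
    exact ⟨g', h1, by linear_combination h2⟩
  init_fst := h.init_snd
  init_snd := h.init_fst
  lim_fst := h.lim_snd
  lim_snd := h.lim_fst

theorem continuousOn_fst (h : IsCharPair a P Q p q f g) : ContinuousOn p (Ici 0) :=
  fun z hz => (h.deriv_fst z hz).continuousWithinAt

theorem continuousOn_snd (h : IsCharPair a P Q p q f g) : ContinuousOn q (Ici 0) :=
  h.swap.continuousOn_fst

theorem continuousOn_deriv_fst (h : IsCharPair a P Q p q f g) : ContinuousOn f (Ici 0) :=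
  fun z hz => (h.ode_fst z hz).choose_spec.1.continuousWithinAt

theorem continuousOn_deriv_snd (h : IsCharPair a P Q p q f g) : ContinuousOn g (Ici 0) :=
  h.swap.continuousOn_deriv_fst

theorem hasDerivWithinAt_deriv_fst (h : IsCharPair a P Q p q f g) {z : ℝ} (hz : 0 ≤ z)
    (hs : 0 < p z + q z) :
    HasDerivWithinAt f (-drift p q g z * f z) (Ici 0) z := by
  obtain ⟨f', h1, h2⟩ := h.ode_fst z hz
  convert h1 using 1
  have := hs.ne'
  unfold drift
  field_simp
  linear_combination (-4) * h2

theorem hasDerivWithinAt_deriv_snd (h : IsCharPair a P Q p q f g) {z : ℝ} (hz : 0 ≤ z)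
    (hs : 0 < p z + q z) :
    HasDerivWithinAt g (-drift q p f z * g z) (Ici 0) z :=
  h.swap.hasDerivWithinAt_deriv_fst hz (by linarith)

/-- Half the sum and half the difference of the characteristic equations. Positivity of p + q makes
f' = -`drift` f continuous, whence the C² regularity. -/
theorem isSolution {δ σ : ℝ} (h : IsCharPair (1 - δ) (1 + σ) (1 - σ) p q f g)
    (hs : ∀ z, 0 ≤ z → 0 < p z + q z) :
    IsSolution δ σ (fun z => (p z + q z) / 2 - (1 - δ) - front δ z)
      (fun z => (p z - q z) / 2 - front σ z) := by
  have e0 := fun c z => (hasDerivAt_front c z).hasDerivWithinAt (s := Ici 0)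
  have e1 := fun c z => (hasDerivAt_frontDeriv c z).hasDerivWithinAt (s := Ici 0)
  have f1 := fun z (hz : 0 ≤ z) => h.hasDerivWithinAt_deriv_fst hz (hs z hz)
  have g1 := fun z (hz : 0 ≤ z) => h.hasDerivWithinAt_deriv_snd hz (hs z hz)
  have u1 : ∀ z, 0 ≤ z → HasDerivWithinAt (fun z => (p z + q z) / 2 - (1 - δ) - front δ z)
      ((f z + g z) / 2 - frontDeriv δ z) (Ici 0) z := fun z hz =>
    ((((h.deriv_fst z hz).add (h.deriv_snd z hz)).div_const 2).sub_const _).sub (e0 δ z)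
  have v1 : ∀ z, 0 ≤ z → HasDerivWithinAt (fun z => (p z - q z) / 2 - front σ z)
      ((f z - g z) / 2 - frontDeriv σ z) (Ici 0) z := fun z hz =>
    (((h.deriv_fst z hz).sub (h.deriv_snd z hz)).div_const 2).sub (e0 σ z)
  have u2 := fun z (hz : 0 ≤ z) => (((f1 z hz).add (g1 z hz)).div_const 2).sub (e1 δ z)
  have v2 := fun z (hz : 0 ≤ z) => (((f1 z hz).sub (g1 z hz)).div_const 2).sub (e1 σ z)
  have cp := h.continuousOn_fst
  have cq := h.continuousOn_snd
  have cb := continuousOn_drift cp cq h.continuousOn_deriv_snd hs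
  have cb' := continuousOn_drift cq cp h.continuousOn_deriv_fst
    (fun z hz => by linarith [hs z hz])
  have cf := h.continuousOn_deriv_fst
  have cg := h.continuousOn_deriv_snd
  have cF : ∀ c, ContinuousOn (fun z => -(z / 2) * frontDeriv c z) (Ici 0) := fun c => by
    unfold frontDeriv; fun_prop
  refine ⟨?_, ?_, fun z hz => ?_, fun z hz => ?_, ?_, ?_, ?_, ?_⟩
  · refine contDiffOn_succ_of_hasDerivWithinAt (n := 1) u1
      (contDiffOn_succ_of_hasDerivWithinAt (n := 0) u2 ?_)
    rw [Nat.cast_zero, contDiffOn_zero]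
    exact (((cb.neg.mul cf).add (cb'.neg.mul cg)).div_const 2).sub (cF δ)
  · refine contDiffOn_succ_of_hasDerivWithinAt (n := 1) v1
      (contDiffOn_succ_of_hasDerivWithinAt (n := 0) v2 ?_)
    rw [Nat.cast_zero, contDiffOn_zero]
    exact (((cb.neg.mul cf).sub (cb'.neg.mul cg)).div_const 2).sub (cF σ)
  · rw [hderiv_one_front _ hz, hderiv_two_front _ hz, hderiv_one_front _ hz,
      hderiv_one_of_hasDerivWithinAt u1 hz, hderiv_one_of_hasDerivWithinAt v1 hz,
      hderiv_two_of_hasDerivWithinAt u1 u2 hz]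
    have := (hs z hz).ne'
    have := (by linarith [hs z hz] : 0 < q z + p z).ne'
    unfold drift
    field_simp
    ring
  · rw [hderiv_one_front _ hz, hderiv_two_front _ hz,
      hderiv_one_of_hasDerivWithinAt u1 hz, hderiv_one_of_hasDerivWithinAt v1 hz,
      hderiv_two_of_hasDerivWithinAt v1 v2 hz]
    have := (hs z hz).ne'
    have := (by linarith [hs z hz] : 0 < q z + p z).ne'
    unfold drift
    field_simp
    ring
  · simp [h.init_fst, h.init_snd, front_zero]
  · simp [h.init_fst, h.init_snd, front_zero]
  · have := (((h.lim_fst.add h.lim_snd).div_const 2).sub_const (1 - δ)).sub (tendsto_front δ)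
    convert this using 2
    ring
  · have := ((h.lim_fst.sub h.lim_snd).div_const 2).sub (tendsto_front σ)
    convert this using 2
    ring

end IsCharPair

/-- Sum and difference of the two equations. No sign of p + q is needed, because `IsCharPair` keeps
the factor u² undivided. -/
theorem IsSolution.isCharPair {δ σ : ℝ} {φ ψ : ℝ → ℝ} (h : IsSolution δ σ φ ψ) :
    IsCharPair (1 - δ) (1 + σ) (1 - σ)
      (fun z => (1 - δ + φ z + front δ z) + (ψ z + front σ z))
      (fun z => (1 - δ + φ z + front δ z) - (ψ z + front σ z))
      (fun z => (hderiv 1 φ z + frontDeriv δ z) + (hderiv 1 ψ z + frontDeriv σ z))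
      (fun z => (hderiv 1 φ z + frontDeriv δ z) - (hderiv 1 ψ z + frontDeriv σ z)) := by
  have d0 : ∀ {χ : ℝ → ℝ}, ContDiffOn ℝ 2 χ (Ici 0) → ∀ z, 0 ≤ z →
      HasDerivWithinAt χ (hderiv 1 χ z) (Ici 0) z := fun hχ z hz => by
    simpa [hderiv_zero] using hasDerivWithinAt_hderiv (k := 0) hχ (by norm_num) hz
  have d1 : ∀ {χ : ℝ → ℝ}, ContDiffOn ℝ 2 χ (Ici 0) → ∀ z, 0 ≤ z →
      HasDerivWithinAt (hderiv 1 χ) (hderiv 2 χ z) (Ici 0) z := fun hχ z hz =>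
    hasDerivWithinAt_hderiv (k := 1) hχ (by norm_num) hz
  have e0 := fun c z => (hasDerivAt_front c z).hasDerivWithinAt (s := Ici 0)
  have e1 := fun c z => (hasDerivAt_frontDeriv c z).hasDerivWithinAt (s := Ici 0)
  have lu : Tendsto (fun z => 1 - δ + φ z + front δ z) atTop (𝓝 (1 - δ + 0 + δ)) :=
    (h.infty_fst.const_add _).add (tendsto_front δ)
  have lv : Tendsto (fun z => ψ z + front σ z) atTop (𝓝 (0 + σ)) :=
    h.infty_snd.add (tendsto_front σ)
  refine ⟨fun z hz => ?_, fun z hz => ?_, fun z hz => ?_, fun z hz => ?_, ?_, ?_, ?_, ?_⟩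
  · exact (((d0 h.regular_fst z hz).const_add _).add (e0 δ z)).add
      ((d0 h.regular_snd z hz).add (e0 σ z))
  · exact (((d0 h.regular_fst z hz).const_add _).add (e0 δ z)).sub
      ((d0 h.regular_snd z hz).add (e0 σ z))
  · refine ⟨_, ((d1 h.regular_fst z hz).add (e1 δ z)).add
      ((d1 h.regular_snd z hz).add (e1 σ z)), ?_⟩
    have h1 := h.eq_fst z hz
    have h2 := h.eq_snd z hz
    simp only [hderiv_one_front _ hz, hderiv_two_front _ hz] at h1 h2
    linear_combination h1 + h2
  · refine ⟨_, ((d1 h.regular_fst z hz).add (e1 δ z)).sub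
      ((d1 h.regular_snd z hz).add (e1 σ z)), ?_⟩
    have h1 := h.eq_fst z hz
    have h2 := h.eq_snd z hz
    simp only [hderiv_one_front _ hz, hderiv_two_front _ hz] at h1 h2
    linear_combination h1 - h2
  · simp [h.zero_fst, h.zero_snd, front_zero]
  · simp [h.zero_fst, h.zero_snd, front_zero]
  · convert lu.add lv using 2; ring
  · convert lu.sub lv using 2; ring

/-! ### Scalar linear equations on a half-line -/

theorem hasDerivWithinAt_integral_Ici {b : ℝ → ℝ} {c : ℝ} (hb : ContinuousOn b (Ici c)) {z : ℝ}
    (hz : c ≤ z) : HasDerivWithinAt (fun z => ∫ t in c..z, b t) (b z) (Ici c) z := by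
  -- Freezing b at its value at c to the left of c gives a continuous function on the line with the
  -- same integrals over [c, z].
  have hb' : Continuous fun t => b (max c t) :=
    hb.comp_continuous (by fun_prop) fun t => le_max_left c t
  have h : HasDerivWithinAt (fun z => ∫ t in c..z, b (max c t)) (b z) (Ici c) z := by
    have := (hb'.integral_hasStrictDerivAt c z).hasDerivAt.hasDerivWithinAt (s := Ici c)
    simpa only [max_eq_right hz] using this
  have hEq : ∀ y, c ≤ y → ∫ t in c..y, b t = ∫ t in c..y, b (max c t) := fun y hy =>
    intervalIntegral.integral_congr fun t ht => by
      rw [uIcc_of_le hy] at ht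
      simp only [max_eq_right ht.1]
  exact h.congr (fun y hy => hEq y hy) (hEq z hz)

theorem eq_mul_exp_of_hasDerivWithinAt {b f : ℝ → ℝ} {c : ℝ} (hb : ContinuousOn b (Ici c))
    (hf : ∀ z, c ≤ z → HasDerivWithinAt f (-b z * f z) (Ici c) z) {z : ℝ} (hz : c ≤ z) :
    f z = f c * Real.exp (-∫ t in c..z, b t) := by
  have hd : ∀ y, c ≤ y →
      HasDerivWithinAt (fun y => f y * Real.exp (∫ t in c..y, b t)) 0 (Ici c) y := fun y hy => by
    refine ((hf y hy).mul (hasDerivWithinAt_integral_Ici hb hy).exp).congr_deriv ?_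
    ring
  have := constant_of_has_deriv_right_zero (a := c) (b := z)
    (fun y hy => ((hd y hy.1).continuousWithinAt).mono Icc_subset_Ici_self)
    (fun y hy => (hd y hy.1).mono (Ici_subset_Ici.2 hy.1)) z ⟨hz, le_rfl⟩
  simp only [intervalIntegral.integral_same, Real.exp_zero, mul_one] at this
  rw [← this, mul_assoc, ← Real.exp_add, add_neg_cancel, Real.exp_zero, mul_one]

/-- The integrating factor `exp (-∫₀ᶻ drift)`. -/
noncomputable def decayFactor (p q g : ℝ → ℝ) (z : ℝ) : ℝ :=
  Real.exp (-∫ t in (0 : ℝ)..z, drift p q g t)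

/-! ### Positivity of `p + q` -/

namespace IsCharPair

variable {a P Q : ℝ} {p q f g : ℝ → ℝ}

theorem exists_pos_mul_eq (h : IsCharPair a P Q p q f g) {c z : ℝ} (hc : 0 ≤ c)
    (hs : ∀ y, c ≤ y → 0 < p y + q y) (hz : c ≤ z) : ∃ e, 0 < e ∧ f z = f c * e := by
  have hsub : Ici c ⊆ Ici 0 := Ici_subset_Ici.2 hc
  have hb : ContinuousOn (drift p q g) (Ici c) := continuousOn_drift (h.continuousOn_fst.mono hsub)
    (h.continuousOn_snd.mono hsub) (h.continuousOn_deriv_snd.mono hsub) hs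
  exact ⟨_, Real.exp_pos _, eq_mul_exp_of_hasDerivWithinAt hb
    (fun y hy => (h.hasDerivWithinAt_deriv_fst (hc.trans hy) (hs y hy)).mono hsub) hz⟩

/-- Beyond c the function f solves a linear homogeneous equation, so its sign at one point is its
sign everywhere; a nonpositive sign would force P ≤ p c. The equation may degenerate at c itself,
hence the strict inequalities. -/
theorem deriv_fst_pos (h : IsCharPair a P Q p q f g) {c z : ℝ} (hc : 0 ≤ c)
    (hs : ∀ y, c < y → 0 < p y + q y) (hP : p c < P) (hz : c < z) : 0 < f z := by
  by_contra! hfz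
  have hneg : ∀ y, c < y → f y ≤ 0 := fun y hy => by
    rcases le_total z y with hzy | hzy
    · obtain ⟨e, he, h1⟩ := h.exists_pos_mul_eq (hc.trans hz.le)
        (fun x hx => hs x (hz.trans_le hx)) hzy
      rw [h1]
      exact mul_nonpos_of_nonpos_of_nonneg hfz he.le
    · obtain ⟨e, he, h1⟩ := h.exists_pos_mul_eq (hc.trans hy.le)
        (fun x hx => hs x (hy.trans_le hx)) hzy
      by_contra! hpos
      have := mul_pos hpos he
      linarith
  have hsub : Ici c ⊆ Ici 0 := Ici_subset_Ici.2 hc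
  have hanti : AntitoneOn p (Ici c) := by
    refine antitoneOn_of_hasDerivWithinAt_nonpos (f' := f) (convex_Ici c)
      (h.continuousOn_fst.mono hsub) ?_ ?_
    · intro x hx
      exact (h.deriv_fst x (hsub (interior_subset hx))).mono (interior_subset.trans hsub)
    · intro x hx
      rw [interior_Ici] at hx
      exact hneg x hx
  have : P ≤ p c := le_of_tendsto h.lim_fst <| by
    filter_upwards [eventually_ge_atTop c] with y hy
    exact hanti self_mem_Ici hy hy
  linarith

/-- If p c > 0 then q c < 0 < Q, so g > 0 beyond c. At c, where p + q = 0, the equation reduces to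
(c/2) p g = 0, so g c = 0. Just after c the drift of g has the sign of z p + (p + q) f, which is
near c p(c) > 0; so g cannot increase from 0, a contradiction. -/
theorem not_fst_pos_of_last_zero (h : IsCharPair a P Q p q f g) (hQ : 0 < Q) {c : ℝ} (hc : 0 < c)
    (h0 : p c + q c = 0) (hs : ∀ y, c < y → 0 < p y + q y) : ¬ 0 < p c := by
  intro hp
  have hg : ∀ y, c < y → 0 < g y := fun y hy =>
    h.swap.deriv_fst_pos hc.le (fun x hx => by linarith [hs x hx]) (by linarith) hy
  have hgc : g c = 0 := by
    obtain ⟨g', -, h1⟩ := h.ode_snd c hc.le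
    have : c / 2 * p c * g c = 0 := by
      linear_combination h1 - (g' * (p c + q c) / 4 + f c * g c / 2) * h0
    rcases mul_eq_zero.1 this with h2 | h2
    · exact absurd h2 (by positivity)
    · exact h2
  have hk : ContinuousOn (fun z => z * p z + (p z + q z) * f z) (Ici 0) :=
    (continuousOn_id.mul h.continuousOn_fst).add
      ((h.continuousOn_fst.add h.continuousOn_snd).mul h.continuousOn_deriv_fst)
  have hk' : ∀ᶠ z in 𝓝[>] c, 0 < z * p z + (p z + q z) * f z := by
    refine ((hk c hc.le).mono (Ioi_subset_Ici hc.le)).eventually (lt_mem_nhds ?_)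
    change 0 < c * p c + (p c + q c) * f c
    rw [h0, zero_mul, add_zero]
    positivity
  obtain ⟨d, hcd, hd⟩ := mem_nhdsGT_iff_exists_Ioo_subset.1 hk'
  have hsub : Ico c d ⊆ Ici 0 := fun x hx => hc.le.trans hx.1
  have hanti : AntitoneOn g (Ico c d) := by
    refine antitoneOn_of_hasDerivWithinAt_nonpos (f' := fun z => -drift q p f z * g z)
      (convex_Ico c d) (h.continuousOn_deriv_snd.mono hsub) ?_ ?_
    · intro x hx
      rw [interior_Ico] at hx ⊢
      exact (h.hasDerivWithinAt_deriv_snd (hc.le.trans hx.1.le) (hs x hx.1)).mono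
        (Ioo_subset_Ico_self.trans hsub)
    · intro x hx
      rw [interior_Ico] at hx
      have h1 := hs x hx.1
      have h2 : 0 < x * p x + (p x + q x) * f x := hd hx
      have h3 : drift q p f x = 2 * (x * p x + (p x + q x) * f x) / (p x + q x) ^ 2 := by
        have : q x + p x ≠ 0 := by linarith
        have := h1.ne'
        unfold drift
        field_simp
        ring
      have h4 : 0 < drift q p f x := by rw [h3]; positivity
      have := mul_pos h4 (hg x hx.1)
      linarith
  have hcd' : c < d := hcd
  have := hanti (a := c) ⟨le_rfl, hcd'⟩ (b := (c + d) / 2) ⟨by linarith, by linarith⟩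
    (by linarith)
  have := hg ((c + d) / 2) (by linarith)
  linarith

/-- Consider the last point c with p + q ≤ 0. By `not_fst_pos_of_last_zero`, applied to both
components, p c = q c = 0, and the monotone quantity q f + p g rules this out. -/
theorem add_pos (h : IsCharPair a P Q p q f g) (ha : 0 < a) (hP : 0 < P) (hQ : 0 < Q) {z : ℝ}
    (hz : 0 ≤ z) : 0 < p z + q z := by
  by_contra! hneg
  have hcs : ContinuousOn (fun z => p z + q z) (Ici 0) :=
    h.continuousOn_fst.add h.continuousOn_snd
  have hev : ∀ᶠ y in atTop, 0 < p y + q y :=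
    (h.lim_fst.add h.lim_snd).eventually (lt_mem_nhds (by linarith))
  obtain ⟨N, hN⟩ := eventually_atTop.1 hev
  have hcl : IsClosed (Ici (0 : ℝ) ∩ (fun z => p z + q z) ⁻¹' Iic 0) :=
    hcs.preimage_isClosed_of_isClosed isClosed_Ici isClosed_Iic
  have hbd : ∀ x ∈ Ici (0 : ℝ) ∩ (fun z => p z + q z) ⁻¹' Iic 0, x ≤ N := fun x hx => by
    by_contra! hlt
    exact absurd (hN x hlt.le) (not_lt.2 hx.2)
  have hcomp : IsCompact (Ici (0 : ℝ) ∩ (fun z => p z + q z) ⁻¹' Iic 0) :=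
    isCompact_Icc.of_isClosed_subset hcl fun x hx => (⟨hx.1, hbd x hx⟩ : x ∈ Icc 0 N)
  obtain ⟨c, ⟨hc0, hcneg⟩, hcmax⟩ := hcomp.exists_isGreatest ⟨z, hz, hneg⟩
  have hc0 : 0 ≤ c := hc0
  have hcneg : p c + q c ≤ 0 := hcneg
  have hs : ∀ y, c < y → 0 < p y + q y := fun y hy => by
    by_contra! hy'
    exact absurd (hcmax ⟨hc0.trans hy.le, hy'⟩) (not_le.2 hy)
  have hc : 0 < c := by
    rcases hc0.eq_or_lt with rfl | h1
    · rw [h.init_fst, h.init_snd] at hcneg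
      linarith
    · exact h1
  have h0 : p c + q c = 0 := by
    refine le_antisymm hcneg (ge_of_tendsto ((hcs c hc0).mono (Ioi_subset_Ici hc0)) ?_)
    filter_upwards [self_mem_nhdsWithin] with y hy using (hs y hy).le
  have hp := h.not_fst_pos_of_last_zero hQ hc h0 hs
  have hq := h.swap.not_fst_pos_of_last_zero hP hc (by linarith)
    (fun y hy => by linarith [hs y hy])
  have hp0 : p c = 0 := by linarith
  have hq0 : q c = 0 := by linarith
  have hf : ∀ y, c < y → 0 < f y := fun y hy => h.deriv_fst_pos hc0 hs (by linarith) hy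
  have hg : ∀ y, c < y → 0 < g y := fun y hy =>
    h.swap.deriv_fst_pos hc0 (fun x hx => by linarith [hs x hx]) (by linarith) hy
  have hsub : Ici c ⊆ Ici 0 := Ici_subset_Ici.2 hc0
  have hmono : ∀ {r k : ℝ → ℝ}, (∀ y, 0 ≤ y → HasDerivWithinAt r (k y) (Ici 0) y) →
      (∀ y, c < y → 0 < k y) → r c = 0 → ∀ y, c < y → 0 < r y := fun {r k} hr hk hr0 y hy => by
    have : StrictMonoOn r (Ici c) := by
      refine strictMonoOn_of_hasDerivWithinAt_pos (f' := k) (convex_Ici c)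
        (fun x hx => ((hr x (hsub hx)).mono hsub).continuousWithinAt) ?_ ?_
      · intro x hx
        exact (hr x (hsub (interior_subset hx))).mono (interior_subset.trans hsub)
      · intro x hx
        rw [interior_Ici] at hx
        exact hk x hx
    rw [← hr0]
    exact this self_mem_Ici hy.le hy
  have hpp := hmono h.deriv_fst hf hp0
  have hqp := hmono h.deriv_snd hg hq0
  -- The f g terms cancel in the derivative, leaving -2z (q² f + p² g) / (p + q)² ≤ 0. Yet q f + p g
  -- vanishes at c and is positive beyond it.
  have hanti : AntitoneOn (fun z => q z * f z + p z * g z) (Ici c) := by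
    refine antitoneOn_of_hasDerivWithinAt_nonpos
      (f' := fun z => g z * f z + q z * (-drift p q g z * f z)
        + (f z * g z + p z * (-drift q p f z * g z))) (convex_Ici c)
      (((h.continuousOn_snd.mul h.continuousOn_deriv_fst).add
        (h.continuousOn_fst.mul h.continuousOn_deriv_snd)).mono hsub) ?_ ?_
    · intro x hx
      have hx' : c < x := by rwa [interior_Ici] at hx
      have hx0 := hc0.trans hx'.le
      exact (((h.deriv_snd x hx0).mul (h.hasDerivWithinAt_deriv_fst hx0 (hs x hx'))).add
        ((h.deriv_fst x hx0).mul (h.hasDerivWithinAt_deriv_snd hx0 (hs x hx')))).mono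
        (interior_subset.trans hsub)
    · intro x hx
      rw [interior_Ici] at hx
      have hx0 : 0 < x := hc.trans hx
      have := hf x hx
      have := hg x hx
      have h1 := hs x hx
      have key : g x * f x + q x * (-drift p q g x * f x)
          + (f x * g x + p x * (-drift q p f x * g x))
          = -(2 * x * (q x ^ 2 * f x + p x ^ 2 * g x) / (p x + q x) ^ 2) := by
        have : q x + p x ≠ 0 := by linarith
        have := h1.ne'
        unfold drift
        field_simp
        ring
      rw [key, neg_nonpos]
      positivity
  have h1 := hanti (a := c) self_mem_Ici (b := c + 1) (by simp) (by linarith)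
  simp only [hp0, hq0, zero_mul, add_zero] at h1
  have hc1 : c < c + 1 := by linarith
  have := mul_pos (hqp _ hc1) (hf _ hc1)
  have := mul_pos (hpp _ hc1) (hg _ hc1)
  linarith

end IsCharPair

/-! ### The Gaussian weight -/

/-- The weight `exp (-z² / 8)`. -/
noncomputable def weight (z : ℝ) : ℝ := Real.exp (-z ^ 2 / 8)

theorem weight_pos (z : ℝ) : 0 < weight z := Real.exp_pos _

theorem weight_le_one (z : ℝ) : weight z ≤ 1 :=
  Real.exp_le_one_iff.2 (by have := sq_nonneg z; linarith)

theorem continuous_weight : Continuous weight := by unfold weight; fun_prop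

theorem integrableOn_weight : IntegrableOn weight (Ioi 0) := by
  have : IntegrableOn (fun t : ℝ => Real.exp (-(1 / 8) * t ^ 2)) (Ioi 0) :=
    (integrable_exp_neg_mul_sq (by norm_num)).integrableOn
  refine this.congr_fun (fun t _ => ?_) measurableSet_Ioi
  change Real.exp _ = Real.exp _
  congr 1
  ring

theorem integral_weight_Ioi_le : ∫ t in Ioi 0, weight t ≤ 3 := by
  have h : ∫ t in Ioi 0, weight t = Real.sqrt (Real.pi / (1 / 8)) / 2 := by
    rw [← integral_gaussian_Ioi]
    congr 1
    ext t
    unfold weight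
    congr 1
    ring
  rw [h, div_le_iff₀ (by norm_num)]
  calc Real.sqrt (Real.pi / (1 / 8)) ≤ Real.sqrt (6 ^ 2) :=
        Real.sqrt_le_sqrt (by linarith [Real.pi_lt_four])
    _ = 3 * 2 := by rw [Real.sqrt_sq (by norm_num)]; norm_num

theorem integral_weight_le {z : ℝ} (hz : 0 ≤ z) : ∫ t in (0 : ℝ)..z, weight t ≤ 3 := by
  rw [intervalIntegral.integral_of_le hz]
  exact (setIntegral_mono_set integrableOn_weight
    (Eventually.of_forall fun t => (weight_pos t).le)
    Ioc_subset_Ioi_self.eventuallyLE).trans integral_weight_Ioi_le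

theorem intervalIntegrable_of_continuousOn_Ici {k : ℝ → ℝ} (hk : ContinuousOn k (Ici 0)) {z : ℝ}
    (hz : 0 ≤ z) : IntervalIntegrable k volume 0 z :=
  (hk.mono (by rw [uIcc_of_le hz]; exact Icc_subset_Ici_self)).intervalIntegrable

theorem abs_integral_le_of_abs_le {f k : ℝ → ℝ} {z : ℝ} (hz : 0 ≤ z) (hk : ContinuousOn k (Ici 0))
    (h : ∀ t, 0 ≤ t → |f t| ≤ k t) : |∫ t in (0 : ℝ)..z, f t| ≤ ∫ t in (0 : ℝ)..z, k t := by
  rw [← Real.norm_eq_abs]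
  exact intervalIntegral.norm_integral_le_of_norm_le hz
    (Eventually.of_forall fun t ht => h t ht.1.le) (intervalIntegrable_of_continuousOn_Ici hk hz)

theorem abs_integral_le_of_abs_le_weight {f : ℝ → ℝ} {z M : ℝ} (hz : 0 ≤ z) (hM : 0 ≤ M)
    (h : ∀ t, 0 ≤ t → |f t| ≤ M * weight t) : |∫ t in (0 : ℝ)..z, f t| ≤ 3 * M := by
  refine (abs_integral_le_of_abs_le hz (k := fun t => M * weight t)
    (continuous_weight.const_mul M).continuousOn h).trans ?_
  rw [intervalIntegral.integral_const_mul]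
  linarith [mul_le_mul_of_nonneg_left (integral_weight_le hz) hM]

/-! ### Bounds for the integrating factor -/

/-- Coefficients close to those of the constant state `p = q = 1`. -/
structure NearOne (p q g : ℝ → ℝ) : Prop where
  cont_fst : ContinuousOn p (Ici 0)
  cont_snd : ContinuousOn q (Ici 0)
  cont_deriv : ContinuousOn g (Ici 0)
  abs_fst : ∀ z, 0 ≤ z → |p z - 1| ≤ 1 / 20
  abs_snd : ∀ z, 0 ≤ z → |q z - 1| ≤ 1 / 20
  abs_integral : ∀ z, 0 ≤ z → |∫ t in (0 : ℝ)..z, 2 * g t / (p t + q t)| ≤ 1 / 2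

theorem hasDerivWithinAt_decayFactor {p q g : ℝ → ℝ} (hb : ContinuousOn (drift p q g) (Ici 0))
    {z : ℝ} (hz : 0 ≤ z) :
    HasDerivWithinAt (decayFactor p q g) (-drift p q g z * decayFactor p q g z) (Ici 0) z :=
  ((hasDerivWithinAt_integral_Ici hb hz).neg.exp).congr_deriv (mul_comm _ _)

theorem decayFactor_pos (p q g : ℝ → ℝ) (z : ℝ) : 0 < decayFactor p q g z := Real.exp_pos _

namespace NearOne

variable {p q g : ℝ → ℝ}

theorem add_pos (h : NearOne p q g) {z : ℝ} (hz : 0 ≤ z) : 0 < p z + q z := by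
  have := abs_le.1 (h.abs_fst z hz)
  have := abs_le.1 (h.abs_snd z hz)
  linarith

theorem continuousOn_drift (h : NearOne p q g) : ContinuousOn (drift p q g) (Ici 0) :=
  SelfSimilarProfile.continuousOn_drift h.cont_fst h.cont_snd h.cont_deriv fun _ => h.add_pos

/-- For p = q = 1 the second term of the drift is t/2; for p and q within 1/20 of 1 it lies between
3t/8 and t. The first term contributes at most 1/2 to the integral. -/
theorem integral_drift_mem (h : NearOne p q g) {z : ℝ} (hz : 0 ≤ z) :
    ∫ t in (0 : ℝ)..z, drift p q g t ∈ Icc (3 * z ^ 2 / 16 - 1 / 2) (z ^ 2 / 2 + 1 / 2) := by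
  have hne : ∀ t ∈ Ici (0 : ℝ), p t + q t ≠ 0 := fun t ht => (h.add_pos ht).ne'
  have c1 : ContinuousOn (fun t => 2 * g t / (p t + q t)) (Ici 0) :=
    (continuousOn_const.mul h.cont_deriv).div (h.cont_fst.add h.cont_snd) hne
  have c2 : ContinuousOn (fun t => 2 * t * q t / (p t + q t) ^ 2) (Ici 0) :=
    ((continuousOn_const.mul continuousOn_id).mul h.cont_snd).div
      ((h.cont_fst.add h.cont_snd).pow 2) fun t ht => pow_ne_zero 2 (hne t ht)
  have i2 := intervalIntegrable_of_continuousOn_Ici c2 hz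
  have hsplit : ∫ t in (0 : ℝ)..z, drift p q g t = (∫ t in (0 : ℝ)..z, 2 * g t / (p t + q t))
      + ∫ t in (0 : ℝ)..z, 2 * t * q t / (p t + q t) ^ 2 :=
    intervalIntegral.integral_add (intervalIntegrable_of_continuousOn_Ici c1 hz) i2
  have hb : ∀ t ∈ Icc 0 z, 3 / 8 * t ≤ 2 * t * q t / (p t + q t) ^ 2 ∧
      2 * t * q t / (p t + q t) ^ 2 ≤ t := fun t ht => by
    have h1 := abs_le.1 (h.abs_fst t ht.1)
    have h2 := abs_le.1 (h.abs_snd t ht.1)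
    have hs := h.add_pos ht.1
    have ht0 := ht.1
    rw [le_div_iff₀ (by positivity), div_le_iff₀ (by positivity)]
    have e1 : (p t + q t) ^ 2 ≤ 441 / 100 := by nlinarith
    have e2 : 361 / 100 ≤ (p t + q t) ^ 2 := by nlinarith
    constructor
    · calc 3 / 8 * t * (p t + q t) ^ 2 = t * (3 / 8 * (p t + q t) ^ 2) := by ring
        _ ≤ t * (2 * q t) := mul_le_mul_of_nonneg_left (by linarith) ht0
        _ = _ := by ring
    · calc 2 * t * q t = t * (2 * q t) := by ring
        _ ≤ _ := mul_le_mul_of_nonneg_left (by linarith) ht0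
  have l1 := intervalIntegral.integral_mono_on hz
    ((by fun_prop : Continuous fun t : ℝ => 3 / 8 * t).intervalIntegrable 0 z) i2
    fun t ht => (hb t ht).1
  have l2 := intervalIntegral.integral_mono_on hz i2 (continuous_id.intervalIntegrable 0 z)
    fun t ht => (hb t ht).2
  rw [intervalIntegral.integral_const_mul, integral_id] at l1
  simp only [id, integral_id] at l2
  have := abs_le.1 (h.abs_integral z hz)
  rw [hsplit]
  constructor <;> linarith

/-- The rate 3/16 exceeds the 1/8 of `weight`; the surplus z²/16 pays for a factor 1 + z² in
`abs_decayFactor_sub_le`. -/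
theorem decayFactor_le (h : NearOne p q g) {z : ℝ} (hz : 0 ≤ z) :
    decayFactor p q g z ≤ 2 * Real.exp (-(3 * z ^ 2 / 16)) := by
  have h1 := (h.integral_drift_mem hz).1
  have h2 : Real.exp (1 / 2) ≤ 2 := by
    rw [← Real.le_log_iff_exp_le (by norm_num)]
    linarith [Real.log_two_gt_d9]
  calc decayFactor p q g z ≤ Real.exp (1 / 2 + -(3 * z ^ 2 / 16)) :=
        Real.exp_le_exp.2 (by linarith)
    _ = Real.exp (1 / 2) * Real.exp (-(3 * z ^ 2 / 16)) := Real.exp_add _ _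
    _ ≤ _ := mul_le_mul_of_nonneg_right h2 (Real.exp_pos _).le

theorem decayFactor_le_weight (h : NearOne p q g) {z : ℝ} (hz : 0 ≤ z) :
    decayFactor p q g z ≤ 2 * weight z := by
  refine (h.decayFactor_le hz).trans ?_
  unfold weight
  gcongr
  have := sq_nonneg z
  linarith

theorem continuousOn_decayFactor (h : NearOne p q g) :
    ContinuousOn (decayFactor p q g) (Ici 0) := fun _ hz =>
  (hasDerivWithinAt_decayFactor h.continuousOn_drift hz).continuousWithinAt

theorem integrableOn_decayFactor (h : NearOne p q g) :
    IntegrableOn (decayFactor p q g) (Ioi 0) := by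
  refine Integrable.mono' (integrableOn_weight.const_mul 2)
    ((h.continuousOn_decayFactor.mono Ioi_subset_Ici_self).aestronglyMeasurable
      measurableSet_Ioi) ?_
  filter_upwards [ae_restrict_mem measurableSet_Ioi] with z hz
  rw [Real.norm_of_nonneg (decayFactor_pos p q g z).le]
  exact h.decayFactor_le_weight (le_of_lt hz)

/-- On [0, 1] the integral of the drift is at most 1, and exp(-1) ≥ 1/4. -/
theorem le_integral_decayFactor (h : NearOne p q g) :
    1 / 4 ≤ ∫ t in Ioi 0, decayFactor p q g t := by
  have h1 : ∫ t in Ioc (0 : ℝ) 1, decayFactor p q g t ≤ ∫ t in Ioi 0, decayFactor p q g t :=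
    setIntegral_mono_set h.integrableOn_decayFactor
      (Eventually.of_forall fun t => (decayFactor_pos p q g t).le) Ioc_subset_Ioi_self.eventuallyLE
  rw [← intervalIntegral.integral_of_le zero_le_one] at h1
  refine le_trans ?_ h1
  have h2 : ∀ t ∈ Icc (0 : ℝ) 1, 1 / 4 ≤ decayFactor p q g t := fun t ht => by
    have h3 := (h.integral_drift_mem ht.1).2
    have h4 : t ^ 2 ≤ 1 := by nlinarith [ht.1, ht.2]
    have h5 : Real.exp 1 ≤ 4 := by linarith [Real.exp_one_lt_d9]
    calc (1 : ℝ) / 4 ≤ 1 / Real.exp 1 := by gcongr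
      _ = Real.exp (-1) := by rw [Real.exp_neg, one_div]
      _ ≤ _ := Real.exp_le_exp.2 (by linarith)
  have := intervalIntegral.integral_mono_on zero_le_one
    (continuous_const.intervalIntegrable (0 : ℝ) 1)
    (intervalIntegrable_of_continuousOn_Ici h.continuousOn_decayFactor zero_le_one) h2
  simpa using this

end NearOne

/-- The multiple of the integrating factor with integral `c` over the half-line. -/
noncomputable def normalizedDecay (c : ℝ) (p q g : ℝ → ℝ) (z : ℝ) : ℝ :=
  c * decayFactor p q g z / ∫ t in Ioi 0, decayFactor p q g t

theorem NearOne.abs_normalizedDecay_le {p q g : ℝ → ℝ} (h : NearOne p q g) (c : ℝ) {z : ℝ}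
    (hz : 0 ≤ z) : |normalizedDecay c p q g z| ≤ 8 * |c| * weight z := by
  have h1 := h.decayFactor_le_weight hz
  have h2 := h.le_integral_decayFactor
  have h0 : 0 < ∫ t in Ioi 0, decayFactor p q g t := by linarith
  have h3 : 0 < decayFactor p q g z := Real.exp_pos _
  have := weight_pos z
  unfold normalizedDecay
  rw [abs_div, abs_mul, abs_of_pos h3, abs_of_pos h0, div_le_iff₀ h0]
  calc |c| * decayFactor p q g z ≤ |c| * (2 * weight z) := by gcongr
    _ = 8 * |c| * weight z * (1 / 4) := by ring
    _ ≤ _ := by gcongr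

theorem NearOne.continuousOn_normalizedDecay {p q g : ℝ → ℝ} (h : NearOne p q g) (c : ℝ) :
    ContinuousOn (normalizedDecay c p q g) (Ici 0) :=
  (continuousOn_const.mul h.continuousOn_decayFactor).div_const _

/-! ### Lipschitz dependence on the coefficients -/

theorem abs_exp_sub_exp_le {x y m : ℝ} (hx : Real.exp x ≤ m) (hy : Real.exp y ≤ m) :
    |Real.exp x - Real.exp y| ≤ m * |x - y| := by
  have key : ∀ {x y : ℝ}, Real.exp x ≤ m → Real.exp x - Real.exp y ≤ m * |x - y| := by
    intro x y hx
    have h1 := Real.add_one_le_exp (y - x)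
    have h2 : Real.exp y = Real.exp x * Real.exp (y - x) := by
      rw [← Real.exp_add]; congr 1; ring
    calc Real.exp x - Real.exp y = Real.exp x * (1 - Real.exp (y - x)) := by rw [h2]; ring
      _ ≤ Real.exp x * |x - y| := by
          gcongr
          exact le_trans (by linarith) (le_abs_self _)
      _ ≤ _ := by gcongr
  refine abs_le.2 ⟨?_, key hx⟩
  have := key (x := y) (y := x) hy
  rw [abs_sub_comm] at this
  linarith

theorem abs_drift_sub_le {p₁ q₁ g₁ p₂ q₂ g₂ : ℝ → ℝ} {D t : ℝ} (ht : 0 ≤ t) (hD : 0 ≤ D)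
    (h₁ : NearOne p₁ q₁ g₁) (h₂ : NearOne p₂ q₂ g₂) (hg₂ : |g₂ t| ≤ weight t / 10)
    (hp : |p₁ t - p₂ t| ≤ 3 * D) (hq : |q₁ t - q₂ t| ≤ 3 * D)
    (hg : |g₁ t - g₂ t| ≤ D * weight t) :
    |drift p₁ q₁ g₁ t - drift p₂ q₂ g₂ t| ≤ 2 * D * weight t + 7 * D * t := by
  -- p + q ≥ 19/10, so its reciprocal is at most 53/100.
  have hr : ∀ {p q g : ℝ → ℝ}, NearOne p q g →
      0 < (p t + q t)⁻¹ ∧ (p t + q t)⁻¹ ≤ 53 / 100 := fun {p q g} h => by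
    have := abs_le.1 (h.abs_fst t ht)
    have := abs_le.1 (h.abs_snd t ht)
    refine ⟨inv_pos.2 (h.add_pos ht), ?_⟩
    rw [inv_le_comm₀ (h.add_pos ht) (by norm_num)]
    linarith
  obtain ⟨r₁, hr₁⟩ : ∃ r, r = (p₁ t + q₁ t)⁻¹ := ⟨_, rfl⟩
  obtain ⟨r₂, hr₂⟩ : ∃ r, r = (p₂ t + q₂ t)⁻¹ := ⟨_, rfl⟩
  obtain ⟨a₁, b₁⟩ := hr h₁
  obtain ⟨a₂, b₂⟩ := hr h₂
  have hq₂ : |q₂ t| ≤ 21 / 20 := by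
    have := abs_le.1 (h₂.abs_snd t ht)
    exact abs_le.2 ⟨by linarith, by linarith⟩
  have hrr : |r₁ - r₂| ≤ 2 * D := by
    have e : r₁ - r₂ = -((p₁ t - p₂ t) + (q₁ t - q₂ t)) * (r₁ * r₂) := by
      have := (h₁.add_pos ht).ne'
      have := (h₂.add_pos ht).ne'
      rw [hr₁, hr₂]
      field_simp
      ring
    rw [← hr₁] at a₁ b₁
    rw [← hr₂] at a₂ b₂
    rw [e, abs_mul, abs_neg, abs_of_pos (mul_pos a₁ a₂)]
    have e2 : |p₁ t - p₂ t + (q₁ t - q₂ t)| ≤ 6 * D := (abs_add_le _ _).trans (by linarith)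
    calc _ ≤ 6 * D * (53 / 100 * (53 / 100)) := by gcongr
      _ ≤ _ := by linarith
  have e : drift p₁ q₁ g₁ t - drift p₂ q₂ g₂ t
      = (2 * (g₁ t - g₂ t) * r₁ + 2 * g₂ t * (r₁ - r₂))
        + 2 * t * ((q₁ t - q₂ t) * r₁ ^ 2 + q₂ t * ((r₁ - r₂) * (r₁ + r₂))) := by
    simp only [drift, div_eq_mul_inv, ← inv_pow, ← hr₁, ← hr₂]
    ring
  rw [← hr₁] at a₁ b₁
  rw [← hr₂] at a₂ b₂
  have hw := weight_pos t
  rw [e]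
  refine (abs_add_le _ _).trans (add_le_add ((abs_add_le _ _).trans ?_) ?_)
  · rw [abs_mul, abs_mul, abs_mul, abs_mul, abs_of_pos a₁, abs_of_pos (two_pos (α := ℝ))]
    calc _ ≤ 2 * (D * weight t) * (53 / 100) + 2 * (weight t / 10) * (2 * D) := by gcongr
      _ ≤ _ := by nlinarith [mul_nonneg hD hw.le]
  · rw [abs_mul, abs_mul, abs_of_nonneg ht, abs_of_pos (two_pos (α := ℝ))]
    have e3 : |(q₁ t - q₂ t) * r₁ ^ 2 + q₂ t * ((r₁ - r₂) * (r₁ + r₂))| ≤ 7 / 2 * D := by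
      refine (abs_add_le _ _).trans ?_
      rw [abs_mul, abs_mul, abs_mul, abs_of_pos (pow_pos a₁ 2),
        abs_of_pos (_root_.add_pos a₁ a₂)]
      calc _ ≤ 3 * D * (53 / 100) ^ 2 + 21 / 20 * (2 * D * (53 / 100 + 53 / 100)) := by gcongr
        _ ≤ _ := by linarith
    calc _ ≤ 2 * t * (7 / 2 * D) := by gcongr
      _ = _ := by ring

/-- The exponents differ by at most the integral of 2D `weight` + 7Dt, that is by at most 6D (1 +
z²), and the exponential is Lipschitz with the common bound of `decayFactor_le`. -/
theorem abs_decayFactor_sub_le {p₁ q₁ g₁ p₂ q₂ g₂ : ℝ → ℝ} {D : ℝ} (hD : 0 ≤ D)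
    (h₁ : NearOne p₁ q₁ g₁) (h₂ : NearOne p₂ q₂ g₂)
    (hg₂ : ∀ t, 0 ≤ t → |g₂ t| ≤ weight t / 10)
    (hp : ∀ t, 0 ≤ t → |p₁ t - p₂ t| ≤ 3 * D) (hq : ∀ t, 0 ≤ t → |q₁ t - q₂ t| ≤ 3 * D)
    (hg : ∀ t, 0 ≤ t → |g₁ t - g₂ t| ≤ D * weight t) {z : ℝ} (hz : 0 ≤ z) :
    |decayFactor p₁ q₁ g₁ z - decayFactor p₂ q₂ g₂ z| ≤ 192 * D * weight z := by
  have h3 : |(-∫ t in (0 : ℝ)..z, drift p₁ q₁ g₁ t) - (-∫ t in (0 : ℝ)..z, drift p₂ q₂ g₂ t)|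
      ≤ 6 * D * (1 + z ^ 2) := by
    rw [← neg_sub_neg, neg_neg, neg_neg, abs_sub_comm, abs_sub_comm,
      ← intervalIntegral.integral_sub
        (intervalIntegrable_of_continuousOn_Ici h₂.continuousOn_drift hz)
        (intervalIntegrable_of_continuousOn_Ici h₁.continuousOn_drift hz)]
    have hc : Continuous fun t => 2 * D * weight t + 7 * D * t :=
      (continuous_weight.const_mul _).add (continuous_const.mul continuous_id)
    refine (abs_integral_le_of_abs_le hz hc.continuousOn fun t ht => ?_).trans ?_
    · rw [abs_sub_comm]
      exact abs_drift_sub_le ht hD h₁ h₂ (hg₂ t ht) (hp t ht) (hq t ht) (hg t ht)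
    · rw [intervalIntegral.integral_add ((continuous_weight.const_mul _).intervalIntegrable _ _)
        ((by fun_prop : Continuous fun t : ℝ => 7 * D * t).intervalIntegrable _ _),
        intervalIntegral.integral_const_mul, intervalIntegral.integral_const_mul]
      simp only [integral_id]
      have := mul_le_mul_of_nonneg_left (integral_weight_le hz) hD
      have := mul_nonneg hD (sq_nonneg z)
      nlinarith
  have h4 := abs_exp_sub_exp_le (h₁.decayFactor_le hz) (h₂.decayFactor_le hz)
  refine h4.trans ((mul_le_mul_of_nonneg_left h3 (by positivity)).trans ?_)
  -- The surplus decay is spent here: -3/16 + 1/16 = -1/8, the exponent of `weight`.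
  have h5 : 1 + z ^ 2 ≤ 16 * Real.exp (z ^ 2 / 16) := by
    have := Real.add_one_le_exp (z ^ 2 / 16)
    have := sq_nonneg z
    linarith
  calc _ ≤ 2 * Real.exp (-(3 * z ^ 2 / 16)) * (6 * D * (16 * Real.exp (z ^ 2 / 16))) := by gcongr
    _ = 192 * D * (Real.exp (-(3 * z ^ 2 / 16)) * Real.exp (z ^ 2 / 16)) := by ring
    _ = 192 * D * weight z := by
      rw [← Real.exp_add]
      unfold weight
      congr 2
      ring

/-- Quotient rule, with the reciprocals of the integrals at most 4 and the integrals differing by at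
most 3 · 192 D: 192 · 4 + 2 · 576 · 16 = 19200. The factor |c| is the source of the contraction. -/
theorem abs_normalizedDecay_sub_le {p₁ q₁ g₁ p₂ q₂ g₂ : ℝ → ℝ} {D : ℝ} (c : ℝ) (hD : 0 ≤ D)
    (h₁ : NearOne p₁ q₁ g₁) (h₂ : NearOne p₂ q₂ g₂)
    (hg₂ : ∀ t, 0 ≤ t → |g₂ t| ≤ weight t / 10)
    (hp : ∀ t, 0 ≤ t → |p₁ t - p₂ t| ≤ 3 * D) (hq : ∀ t, 0 ≤ t → |q₁ t - q₂ t| ≤ 3 * D)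
    (hg : ∀ t, 0 ≤ t → |g₁ t - g₂ t| ≤ D * weight t) {z : ℝ} (hz : 0 ≤ z) :
    |normalizedDecay c p₁ q₁ g₁ z - normalizedDecay c p₂ q₂ g₂ z|
      ≤ 19200 * |c| * D * weight z := by
  have hE := fun {z} (hz : 0 ≤ z) => abs_decayFactor_sub_le hD h₁ h₂ hg₂ hp hq hg (z := z) hz
  have hI : |(∫ t in Ioi 0, decayFactor p₂ q₂ g₂ t) - ∫ t in Ioi 0, decayFactor p₁ q₁ g₁ t|
      ≤ 576 * D := by
    rw [abs_sub_comm, ← integral_sub h₁.integrableOn_decayFactor h₂.integrableOn_decayFactor]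
    have : |∫ t in Ioi 0, (decayFactor p₁ q₁ g₁ t - decayFactor p₂ q₂ g₂ t)|
        ≤ ∫ t in Ioi 0, 192 * D * weight t := by
      rw [← Real.norm_eq_abs]
      refine norm_integral_le_of_norm_le (integrableOn_weight.const_mul _) ?_
      filter_upwards [ae_restrict_mem measurableSet_Ioi] with t ht
      exact hE (le_of_lt ht)
    rw [integral_const_mul] at this
    have := mul_le_mul_of_nonneg_left integral_weight_Ioi_le hD
    linarith
  have hE' := hE hz
  have b := h₂.decayFactor_le_weight hz
  have i₁ := h₁.le_integral_decayFactor
  have i₂ := h₂.le_integral_decayFactor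
  have e₂ : 0 < decayFactor p₂ q₂ g₂ z := Real.exp_pos _
  unfold normalizedDecay
  generalize decayFactor p₁ q₁ g₁ z = E₁ at *
  generalize decayFactor p₂ q₂ g₂ z = E₂ at *
  generalize ∫ t in Ioi 0, decayFactor p₁ q₁ g₁ t = I₁ at *
  generalize ∫ t in Ioi 0, decayFactor p₂ q₂ g₂ t = I₂ at *
  have hI₁ : 0 < I₁ := by linarith
  have hI₂ : 0 < I₂ := by linarith
  have j₁ : I₁⁻¹ ≤ 4 := by rw [inv_le_comm₀ hI₁ (by norm_num)]; linarith
  have j₂ : I₂⁻¹ ≤ 4 := by rw [inv_le_comm₀ hI₂ (by norm_num)]; linarith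
  have k₁ := inv_pos.2 hI₁
  have k₂ := inv_pos.2 hI₂
  have hw := weight_pos z
  have e : c * E₁ / I₁ - c * E₂ / I₂
      = c * ((E₁ - E₂) * I₁⁻¹ + E₂ * ((I₂ - I₁) * (I₁⁻¹ * I₂⁻¹))) := by
    field_simp
    ring
  rw [e, abs_mul]
  have e2 : |(E₁ - E₂) * I₁⁻¹ + E₂ * ((I₂ - I₁) * (I₁⁻¹ * I₂⁻¹))| ≤ 19200 * (D * weight z) := by
    refine (abs_add_le _ _).trans ?_
    rw [abs_mul, abs_mul, abs_mul, abs_of_pos k₁, abs_of_pos e₂, abs_of_pos (mul_pos k₁ k₂)]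
    calc _ ≤ 192 * D * weight z * 4 + 2 * weight z * (576 * D * (4 * 4)) := by gcongr
      _ = _ := by ring
  calc _ ≤ |c| * (19200 * (D * weight z)) := by gcongr
    _ = _ := by ring

/-! ### The fixed point problem for the derivatives -/

/-- The integral equation equivalent to the boundary value problem in characteristic variables. -/
structure IsFixedPair (M a P Q : ℝ) (p q f g : ℝ → ℝ) : Prop where
  cont_fst : ContinuousOn f (Ici 0)
  cont_snd : ContinuousOn g (Ici 0)
  int_fst : ∀ z, 0 ≤ z → p z = a + ∫ t in (0 : ℝ)..z, f t
  int_snd : ∀ z, 0 ≤ z → q z = a + ∫ t in (0 : ℝ)..z, g t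
  bound_fst : ∀ z, 0 ≤ z → |f z| ≤ M * weight z
  bound_snd : ∀ z, 0 ≤ z → |g z| ≤ M * weight z
  fix_fst : ∀ z, 0 ≤ z → f z = normalizedDecay (P - a) p q g z
  fix_snd : ∀ z, 0 ≤ z → g z = normalizedDecay (Q - a) q p f z

theorem hasDerivWithinAt_of_eq_integral {p f : ℝ → ℝ} {a : ℝ} (hf : ContinuousOn f (Ici 0))
    (hp : ∀ z, 0 ≤ z → p z = a + ∫ t in (0 : ℝ)..z, f t) {z : ℝ} (hz : 0 ≤ z) :
    HasDerivWithinAt p (f z) (Ici 0) z :=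
  ((hasDerivWithinAt_integral_Ici hf hz).const_add a).congr (fun y hy => hp y hy) (hp z hz)

theorem eq_integral_of_hasDerivWithinAt {p f : ℝ → ℝ} (hf : ContinuousOn f (Ici 0))
    (hp : ∀ z, 0 ≤ z → HasDerivWithinAt p (f z) (Ici 0) z) {z : ℝ} (hz : 0 ≤ z) :
    p z = p 0 + ∫ t in (0 : ℝ)..z, f t := by
  rw [intervalIntegral.integral_eq_sub_of_hasDeriv_right_of_le hz
    (fun y hy => (hp y hy.1).continuousWithinAt.mono Icc_subset_Ici_self)
    (fun y hy => (hp y hy.1.le).mono (Ioi_subset_Ici hy.1.le))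
    (intervalIntegrable_of_continuousOn_Ici hf hz)]
  ring

/-- Since `weight` has integral at most 3, p and q stay within |a - 1| + 3M of 1. -/
theorem nearOne_of_abs_le_weight {M a : ℝ} {p q f g : ℝ → ℝ} (hM : 0 ≤ M) (hM' : M ≤ 1 / 1000)
    (ha : |a - 1| ≤ 1 / 100000) (hf : ContinuousOn f (Ici 0)) (hg : ContinuousOn g (Ici 0))
    (hp : ∀ z, 0 ≤ z → p z = a + ∫ t in (0 : ℝ)..z, f t)
    (hq : ∀ z, 0 ≤ z → q z = a + ∫ t in (0 : ℝ)..z, g t)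
    (bf : ∀ z, 0 ≤ z → |f z| ≤ M * weight z) (bg : ∀ z, 0 ≤ z → |g z| ≤ M * weight z) :
    NearOne p q g := by
  have key : ∀ {r k : ℝ → ℝ}, (∀ z, 0 ≤ z → r z = a + ∫ t in (0 : ℝ)..z, k t) →
      (∀ z, 0 ≤ z → |k z| ≤ M * weight z) → ∀ z, 0 ≤ z → |r z - 1| ≤ 1 / 20 := by
    intro r k hr hk z hz
    rw [hr z hz, show (a + ∫ t in (0 : ℝ)..z, k t) - 1 = (a - 1) + ∫ t in (0 : ℝ)..z, k t by ring]
    have := abs_integral_le_of_abs_le_weight hz hM hk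
    exact (abs_add_le _ _).trans (by linarith)
  have kp := key hp bf
  have kq := key hq bg
  refine ⟨fun z hz => (hasDerivWithinAt_of_eq_integral hf hp hz).continuousWithinAt,
    fun z hz => (hasDerivWithinAt_of_eq_integral hg hq hz).continuousWithinAt, hg, kp, kq,
    fun z hz => ?_⟩
  refine (abs_integral_le_of_abs_le_weight (M := 2 * M) hz (by positivity)
    fun t ht => ?_).trans (by linarith)
  have h1 := abs_le.1 (kp t ht)
  have h2 := abs_le.1 (kq t ht)
  rw [abs_div, abs_mul, abs_of_pos (two_pos (α := ℝ)), abs_of_pos (by linarith : 0 < p t + q t)]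
  refine (div_le_self (by positivity) (by linarith)).trans ?_
  linarith [bg t ht]

namespace IsFixedPair

variable {M a P Q : ℝ} {p q f g : ℝ → ℝ}

theorem swap (h : IsFixedPair M a P Q p q f g) : IsFixedPair M a Q P q p g f :=
  ⟨h.cont_snd, h.cont_fst, h.int_snd, h.int_fst, h.bound_snd, h.bound_fst, h.fix_snd, h.fix_fst⟩

theorem nearOne (h : IsFixedPair M a P Q p q f g) (hM : 0 ≤ M) (hM' : M ≤ 1 / 1000)
    (ha : |a - 1| ≤ 1 / 100000) : NearOne p q g :=
  nearOne_of_abs_le_weight hM hM' ha h.cont_fst h.cont_snd h.int_fst h.int_snd h.bound_fst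
    h.bound_snd

theorem ode_fst (h : IsFixedPair M a P Q p q f g) (hn : NearOne p q g) {z : ℝ} (hz : 0 ≤ z) :
    ∃ f', HasDerivWithinAt f f' (Ici 0) z ∧
    ((p z + q z) / 2) ^ 2 * f' + (p z + q z) / 2 * (f z * g z) + z / 2 * (q z * f z) = 0 := by
  have h1 : HasDerivWithinAt (normalizedDecay (P - a) p q g)
      (-drift p q g z * normalizedDecay (P - a) p q g z) (Ici 0) z :=
    (((hasDerivWithinAt_decayFactor hn.continuousOn_drift hz).const_mul (P - a)).div_const
      (∫ t in Ioi 0, decayFactor p q g t)).congr_deriv (by unfold normalizedDecay; ring)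
  refine ⟨-drift p q g z * f z, ?_, ?_⟩
  · rw [h.fix_fst z hz]
    exact h1.congr (fun y hy => h.fix_fst y hy) (h.fix_fst z hz)
  · have := (hn.add_pos hz).ne'
    unfold drift
    field_simp
    ring

theorem lim_fst (h : IsFixedPair M a P Q p q f g) (hn : NearOne p q g) :
    Tendsto p atTop (𝓝 P) := by
  have hI := hn.le_integral_decayFactor
  have h1 := intervalIntegral_tendsto_integral_Ioi 0 hn.integrableOn_decayFactor tendsto_id
  have h2 := ((h1.const_mul (P - a)).div_const (∫ t in Ioi 0, decayFactor p q g t)).const_add a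
  rw [mul_div_cancel_right₀ _ (by linarith : (∫ t in Ioi 0, decayFactor p q g t) ≠ 0),
    add_sub_cancel] at h2
  refine h2.congr' ?_
  filter_upwards [eventually_ge_atTop 0] with z hz
  rw [h.int_fst z hz, ← intervalIntegral.integral_const_mul, ← intervalIntegral.integral_div]
  congr 1
  refine intervalIntegral.integral_congr fun t ht => ?_
  rw [id, uIcc_of_le hz] at ht
  exact (h.fix_fst t ht.1).symm

theorem isCharPair (h : IsFixedPair M a P Q p q f g) (hM : 0 ≤ M) (hM' : M ≤ 1 / 1000)
    (ha : |a - 1| ≤ 1 / 100000) : IsCharPair a P Q p q f g where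
  deriv_fst _ := hasDerivWithinAt_of_eq_integral h.cont_fst h.int_fst
  deriv_snd _ := hasDerivWithinAt_of_eq_integral h.cont_snd h.int_snd
  ode_fst _ := h.ode_fst (h.nearOne hM hM' ha)
  ode_snd z hz := by
    obtain ⟨g', h1, h2⟩ := h.swap.ode_fst (h.swap.nearOne hM hM' ha) hz
    exact ⟨g', h1, by linear_combination h2⟩
  init_fst := by simp [h.int_fst 0 le_rfl]
  init_snd := by simp [h.int_snd 0 le_rfl]
  lim_fst := h.lim_fst (h.nearOne hM hM' ha)
  lim_snd := h.swap.lim_fst (h.swap.nearOne hM hM' ha)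

end IsFixedPair

/-! ### From the boundary value problem to the integral equation -/

namespace IsCharPair

variable {a P Q : ℝ} {p q f g : ℝ → ℝ}

theorem deriv_fst_eq (h : IsCharPair a P Q p q f g) (hs : ∀ z, 0 ≤ z → 0 < p z + q z) {z : ℝ}
    (hz : 0 ≤ z) : f z = f 0 * decayFactor p q g z :=
  eq_mul_exp_of_hasDerivWithinAt (continuousOn_drift h.continuousOn_fst h.continuousOn_snd
    h.continuousOn_deriv_snd hs) (fun _ hy => h.hasDerivWithinAt_deriv_fst hy (hs _ hy)) hz

theorem continuousOn_decayFactor (h : IsCharPair a P Q p q f g)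
    (hs : ∀ z, 0 ≤ z → 0 < p z + q z) : ContinuousOn (decayFactor p q g) (Ici 0) := fun _ hz =>
  (hasDerivWithinAt_decayFactor (continuousOn_drift h.continuousOn_fst h.continuousOn_snd
    h.continuousOn_deriv_snd hs) hz).continuousWithinAt

theorem fst_sub_eq (h : IsCharPair a P Q p q f g) (hs : ∀ z, 0 ≤ z → 0 < p z + q z) {z : ℝ}
    (hz : 0 ≤ z) : p z - a = f 0 * ∫ t in (0 : ℝ)..z, decayFactor p q g t := by
  rw [eq_integral_of_hasDerivWithinAt h.continuousOn_deriv_fst h.deriv_fst hz, h.init_fst,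
    add_sub_cancel_left, ← intervalIntegral.integral_const_mul]
  refine intervalIntegral.integral_congr fun t ht => ?_
  rw [uIcc_of_le hz] at ht
  exact h.deriv_fst_eq hs ht.1

/-- f keeps the sign of f 0, so |p - a| is nondecreasing with limit |P - a|. This confines p with no
bound on f given in advance. -/
theorem abs_mul_integral_le (h : IsCharPair a P Q p q f g) (hs : ∀ z, 0 ≤ z → 0 < p z + q z)
    {z : ℝ} (hz : 0 ≤ z) :
    |f 0| * (∫ t in (0 : ℝ)..z, decayFactor p q g t) ≤ |P - a| := by
  refine ge_of_tendsto (h.lim_fst.sub_const a).abs ?_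
  filter_upwards [eventually_ge_atTop z] with y hy
  have hy0 := hz.trans hy
  have hJ : ∀ x, 0 ≤ x → 0 ≤ ∫ t in (0 : ℝ)..x, decayFactor p q g t := fun x hx =>
    intervalIntegral.integral_nonneg hx fun t _ => (decayFactor_pos p q g t).le
  rw [h.fst_sub_eq hs hy0, abs_mul, abs_of_nonneg (hJ y hy0)]
  refine mul_le_mul_of_nonneg_left ?_ (abs_nonneg _)
  exact intervalIntegral.integral_mono_interval le_rfl hz hy
    (Eventually.of_forall fun t => (decayFactor_pos p q g t).le)
    (intervalIntegrable_of_continuousOn_Ici (h.continuousOn_decayFactor hs) hy0)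

theorem abs_fst_sub_one_le {η : ℝ} (h : IsCharPair a P Q p q f g)
    (hs : ∀ z, 0 ≤ z → 0 < p z + q z) (ha : |a - 1| ≤ 1 / 100000) (hP : |P - a| ≤ η)
    (hη : η ≤ 2 / 100000) {z : ℝ} (hz : 0 ≤ z) : |p z - 1| ≤ 1 / 20 := by
  have h1 := h.abs_mul_integral_le hs hz
  have hJ : 0 ≤ ∫ t in (0 : ℝ)..z, decayFactor p q g t :=
    intervalIntegral.integral_nonneg hz fun t _ => (decayFactor_pos p q g t).le
  have h2 : |p z - a| ≤ |P - a| := by rwa [h.fst_sub_eq hs hz, abs_mul, abs_of_nonneg hJ]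
  have := abs_sub_le (p z) a 1
  linarith

/-- No pointwise decay of g is known yet, but g is g 0 times a positive factor of controlled
integral, so the integral of |2g / (p + q)| is at most 2 |Q - a|. This is why `NearOne` constrains
only the integral. -/
theorem nearOne {η : ℝ} (h : IsCharPair a P Q p q f g) (hs : ∀ z, 0 ≤ z → 0 < p z + q z)
    (ha : |a - 1| ≤ 1 / 100000) (hP : |P - a| ≤ η) (hQ : |Q - a| ≤ η) (hη : η ≤ 2 / 100000) :
    NearOne p q g := by
  have hs' : ∀ z, 0 ≤ z → 0 < q z + p z := fun z hz => by linarith [hs z hz]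
  have kp := fun z (hz : 0 ≤ z) => h.abs_fst_sub_one_le hs ha hP hη hz
  have kq := fun z (hz : 0 ≤ z) => h.swap.abs_fst_sub_one_le hs' ha hQ hη hz
  refine ⟨h.continuousOn_fst, h.continuousOn_snd, h.continuousOn_deriv_snd, kp, kq,
    fun z hz => ?_⟩
  have hb : ∀ t, 0 ≤ t → |2 * g t / (p t + q t)| ≤ 2 * |g 0| * decayFactor q p f t :=
    fun t ht => by
      have h1 := abs_le.1 (kp t ht)
      have h2 := abs_le.1 (kq t ht)
      rw [abs_div, abs_mul, abs_of_pos (two_pos (α := ℝ)),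
        abs_of_pos (by linarith : 0 < p t + q t)]
      refine (div_le_self (by positivity) (by linarith)).trans ?_
      rw [h.swap.deriv_fst_eq hs' ht, abs_mul, abs_of_pos (decayFactor_pos q p f t), mul_assoc]
  refine (abs_integral_le_of_abs_le hz (k := fun t => 2 * |g 0| * decayFactor q p f t)
    (continuousOn_const.mul (h.swap.continuousOn_decayFactor hs')) hb).trans ?_
  rw [intervalIntegral.integral_const_mul]
  have := h.swap.abs_mul_integral_le hs' hz
  linarith

theorem deriv_fst_eq_normalizedDecay (h : IsCharPair a P Q p q f g) (hn : NearOne p q g) {z : ℝ}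
    (hz : 0 ≤ z) : f z = normalizedDecay (P - a) p q g z := by
  have hs : ∀ z, 0 ≤ z → 0 < p z + q z := fun _ => hn.add_pos
  have hI := hn.le_integral_decayFactor
  have h1 := (intervalIntegral_tendsto_integral_Ioi 0 hn.integrableOn_decayFactor
    tendsto_id).const_mul (f 0)
  have h2 := tendsto_nhds_unique (h1.congr' (by
    filter_upwards [eventually_ge_atTop 0] with y hy
    exact (h.fst_sub_eq hs hy).symm)) (h.lim_fst.sub_const a)
  have hI0 : (∫ t in Ioi 0, decayFactor p q g t) ≠ 0 := by linarith
  rw [h.deriv_fst_eq hs hz, normalizedDecay, ← h2]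
  field_simp

theorem isFixedPair {η : ℝ} (h : IsCharPair a P Q p q f g) (hs : ∀ z, 0 ≤ z → 0 < p z + q z)
    (ha : |a - 1| ≤ 1 / 100000) (hP : |P - a| ≤ η) (hQ : |Q - a| ≤ η) (hη : η ≤ 2 / 100000) :
    IsFixedPair (8 * η) a P Q p q f g := by
  have hn := h.nearOne hs ha hP hQ hη
  have hn' := h.swap.nearOne (fun z hz => by linarith [hs z hz]) ha hQ hP hη
  have f1 := fun z (hz : 0 ≤ z) => h.deriv_fst_eq_normalizedDecay hn hz
  have g1 := fun z (hz : 0 ≤ z) => h.swap.deriv_fst_eq_normalizedDecay hn' hz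
  have bound : ∀ {c z : ℝ}, |c| ≤ η → 8 * |c| * weight z ≤ 8 * η * weight z := fun hc => by
    have := weight_pos
    gcongr
    exact (this _).le
  refine ⟨h.continuousOn_deriv_fst, h.continuousOn_deriv_snd, fun z hz => ?_, fun z hz => ?_,
    fun z hz => ?_, fun z hz => ?_, f1, g1⟩
  · rw [← h.init_fst]
    exact eq_integral_of_hasDerivWithinAt h.continuousOn_deriv_fst h.deriv_fst hz
  · rw [← h.init_snd]
    exact eq_integral_of_hasDerivWithinAt h.continuousOn_deriv_snd h.deriv_snd hz
  · rw [f1 z hz]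
    exact (hn.abs_normalizedDecay_le _ hz).trans (bound hP)
  · rw [g1 z hz]
    exact (hn'.abs_normalizedDecay_le _ hz).trans (bound hQ)

end IsCharPair

/-! ### Uniqueness and existence for the fixed point problem -/

theorem abs_sub_le_of_eq_integral {p₁ p₂ f₁ f₂ : ℝ → ℝ} {a D : ℝ} (hD : 0 ≤ D)
    (c₁ : ContinuousOn f₁ (Ici 0)) (c₂ : ContinuousOn f₂ (Ici 0))
    (h₁ : ∀ z, 0 ≤ z → p₁ z = a + ∫ t in (0 : ℝ)..z, f₁ t)
    (h₂ : ∀ z, 0 ≤ z → p₂ z = a + ∫ t in (0 : ℝ)..z, f₂ t)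
    (h : ∀ z, 0 ≤ z → |f₁ z - f₂ z| ≤ D * weight z) {z : ℝ} (hz : 0 ≤ z) :
    |p₁ z - p₂ z| ≤ 3 * D := by
  rw [h₁ z hz, h₂ z hz, add_sub_add_left_eq_sub, ← intervalIntegral.integral_sub
    (intervalIntegrable_of_continuousOn_Ici c₁ hz) (intervalIntegrable_of_continuousOn_Ici c₂ hz)]
  exact abs_integral_le_of_abs_le_weight hz hD h

/-- 19200 · 2/100000 < 1/2: this is what the threshold 1/100000 on δ and σ secures. -/
theorem abs_normalizedDecay_sub_le_half {a c D : ℝ} {p₁ q₁ f₁ g₁ p₂ q₂ f₂ g₂ : ℝ → ℝ}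
    (hD : 0 ≤ D) (hc : |c| ≤ 2 / 100000) (n₁ : NearOne p₁ q₁ g₁) (n₂ : NearOne p₂ q₂ g₂)
    (c₁ : ContinuousOn f₁ (Ici 0)) (c₂ : ContinuousOn f₂ (Ici 0))
    (ip₁ : ∀ z, 0 ≤ z → p₁ z = a + ∫ t in (0 : ℝ)..z, f₁ t)
    (ip₂ : ∀ z, 0 ≤ z → p₂ z = a + ∫ t in (0 : ℝ)..z, f₂ t)
    (iq₁ : ∀ z, 0 ≤ z → q₁ z = a + ∫ t in (0 : ℝ)..z, g₁ t)
    (iq₂ : ∀ z, 0 ≤ z → q₂ z = a + ∫ t in (0 : ℝ)..z, g₂ t)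
    (hg₂ : ∀ t, 0 ≤ t → |g₂ t| ≤ 1 / 1000 * weight t)
    (hf : ∀ z, 0 ≤ z → |f₁ z - f₂ z| ≤ D * weight z)
    (hg : ∀ z, 0 ≤ z → |g₁ z - g₂ z| ≤ D * weight z) {z : ℝ} (hz : 0 ≤ z) :
    |normalizedDecay c p₁ q₁ g₁ z - normalizedDecay c p₂ q₂ g₂ z| ≤ D / 2 * weight z := by
  refine (abs_normalizedDecay_sub_le c hD n₁ n₂
    (fun t ht => (hg₂ t ht).trans (by linarith [weight_pos t]))
    (fun t ht => abs_sub_le_of_eq_integral hD c₁ c₂ ip₁ ip₂ hf ht)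
    (fun t ht => abs_sub_le_of_eq_integral hD n₁.cont_deriv n₂.cont_deriv iq₁ iq₂ hg ht)
    hg hz).trans ?_
  have hw := mul_nonneg hD (weight_pos z).le
  calc 19200 * |c| * D * weight z = 19200 * |c| * (D * weight z) := by ring
    _ ≤ 1 / 2 * (D * weight z) := mul_le_mul_of_nonneg_right (by linarith) hw
    _ = _ := by ring

namespace IsFixedPair

variable {M a P Q : ℝ} {p₁ q₁ f₁ g₁ p₂ q₂ f₂ g₂ : ℝ → ℝ}

/-- Two fixed pairs differ by at most 2M `weight`, and each pass through the fixed point equations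
halves this bound. -/
theorem abs_sub_le (hM : 0 ≤ M) (hM' : M ≤ 1 / 1000) (ha : |a - 1| ≤ 1 / 100000)
    (hP : |P - a| ≤ 2 / 100000) (hQ : |Q - a| ≤ 2 / 100000)
    (h₁ : IsFixedPair M a P Q p₁ q₁ f₁ g₁) (h₂ : IsFixedPair M a P Q p₂ q₂ f₂ g₂) (n : ℕ) :
    (∀ z, 0 ≤ z → |f₁ z - f₂ z| ≤ 2 * M / 2 ^ n * weight z) ∧
      ∀ z, 0 ≤ z → |g₁ z - g₂ z| ≤ 2 * M / 2 ^ n * weight z := by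
  have hbM : ∀ z, M * weight z ≤ 1 / 1000 * weight z := fun z =>
    mul_le_mul_of_nonneg_right hM' (weight_pos z).le
  induction n with
  | zero =>
    refine ⟨fun z hz => (abs_sub _ _).trans ?_, fun z hz => (abs_sub _ _).trans ?_⟩
    · linarith [h₁.bound_fst z hz, h₂.bound_fst z hz]
    · linarith [h₁.bound_snd z hz, h₂.bound_snd z hz]
  | succ n ih =>
    have hD : 0 ≤ 2 * M / 2 ^ n := by positivity
    have e : 2 * M / 2 ^ (n + 1) = 2 * M / 2 ^ n / 2 := by rw [pow_succ]; ring
    rw [e]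
    refine ⟨fun z hz => ?_, fun z hz => ?_⟩
    · rw [h₁.fix_fst z hz, h₂.fix_fst z hz]
      exact abs_normalizedDecay_sub_le_half hD hP (h₁.nearOne hM hM' ha) (h₂.nearOne hM hM' ha)
        h₁.cont_fst h₂.cont_fst h₁.int_fst h₂.int_fst h₁.int_snd h₂.int_snd
        (fun t ht => (h₂.bound_snd t ht).trans (hbM t)) ih.1 ih.2 hz
    · rw [h₁.fix_snd z hz, h₂.fix_snd z hz]
      exact abs_normalizedDecay_sub_le_half hD hQ (h₁.swap.nearOne hM hM' ha)
        (h₂.swap.nearOne hM hM' ha) h₁.cont_snd h₂.cont_snd h₁.int_snd h₂.int_snd h₁.int_fst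
        h₂.int_fst (fun t ht => (h₂.bound_fst t ht).trans (hbM t)) ih.2 ih.1 hz

theorem eqOn (hM : 0 ≤ M) (hM' : M ≤ 1 / 1000) (ha : |a - 1| ≤ 1 / 100000)
    (hP : |P - a| ≤ 2 / 100000) (hQ : |Q - a| ≤ 2 / 100000)
    (h₁ : IsFixedPair M a P Q p₁ q₁ f₁ g₁) (h₂ : IsFixedPair M a P Q p₂ q₂ f₂ g₂) :
    EqOn p₁ p₂ (Ici 0) ∧ EqOn q₁ q₂ (Ici 0) := by
  have hlim : Tendsto (fun n : ℕ => 3 * (2 * M / 2 ^ n)) atTop (𝓝 0) := by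
    have := ((tendsto_pow_atTop_nhds_zero_of_lt_one (r := (1 / 2 : ℝ)) (by norm_num)
      (by norm_num)).const_mul (6 * M))
    rw [mul_zero] at this
    refine this.congr fun n => ?_
    rw [one_div, inv_pow]
    ring
  have key := fun n => abs_sub_le hM hM' ha hP hQ h₁ h₂ n
  refine ⟨fun z hz => ?_, fun z hz => ?_⟩
  · refine sub_eq_zero.1 (abs_nonpos_iff.1 (ge_of_tendsto' hlim fun n => ?_))
    exact abs_sub_le_of_eq_integral (by positivity) h₁.cont_fst h₂.cont_fst h₁.int_fst h₂.int_fst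
      (key n).1 hz
  · refine sub_eq_zero.1 (abs_nonpos_iff.1 (ge_of_tendsto' hlim fun n => ?_))
    exact abs_sub_le_of_eq_integral (by positivity) h₁.cont_snd h₂.cont_snd h₁.int_snd h₂.int_snd
      (key n).2 hz

end IsFixedPair

/-! ### Existence by the contraction principle in a weighted space -/

/-- The function `F * weight` on the half-line, extended to the line. -/
noncomputable def weighted (F : BoundedContinuousFunction ℝ≥0 ℝ) (z : ℝ) : ℝ :=
  F z.toNNReal * weight z

theorem continuous_weighted (F : BoundedContinuousFunction ℝ≥0 ℝ) : Continuous (weighted F) :=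
  (F.continuous.comp continuous_real_toNNReal).mul continuous_weight

theorem abs_weighted_sub_le (F G : BoundedContinuousFunction ℝ≥0 ℝ) (z : ℝ) :
    |weighted F z - weighted G z| ≤ dist F G * weight z := by
  unfold weighted
  rw [← sub_mul, abs_mul, abs_of_pos (weight_pos z)]
  refine mul_le_mul_of_nonneg_right ?_ (weight_pos z).le
  exact BoundedContinuousFunction.dist_coe_le_dist (f := F) (g := G) z.toNNReal

theorem abs_weighted_le {F : BoundedContinuousFunction ℝ≥0 ℝ} {M : ℝ} (hF : ‖F‖ ≤ M) (z : ℝ) :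
    |weighted F z| ≤ M * weight z := by
  unfold weighted
  rw [abs_mul, abs_of_pos (weight_pos z)]
  exact mul_le_mul_of_nonneg_right ((F.norm_coe_le_norm _).trans hF) (weight_pos z).le

theorem exists_weighted_eq {f : ℝ → ℝ} {M : ℝ} (hM : 0 ≤ M) (hf : ContinuousOn f (Ici 0))
    (hb : ∀ z, 0 ≤ z → |f z| ≤ M * weight z) :
    ∃ F : BoundedContinuousFunction ℝ≥0 ℝ, ‖F‖ ≤ M ∧ ∀ z, 0 ≤ z → weighted F z = f z := by
  have hc : Continuous fun x : ℝ≥0 => f x / weight x :=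
    (hf.comp_continuous NNReal.continuous_coe fun x => x.2).div
      (continuous_weight.comp NNReal.continuous_coe) fun x => (weight_pos x).ne'
  have hb' : ∀ x : ℝ≥0, ‖f x / weight x‖ ≤ M := fun x => by
    rw [Real.norm_eq_abs, abs_div, abs_of_pos (weight_pos x), div_le_iff₀ (weight_pos x)]
    exact hb x x.2
  refine ⟨BoundedContinuousFunction.ofNormedAddCommGroup _ hc M hb',
    BoundedContinuousFunction.norm_ofNormedAddCommGroup_le hc hM hb', fun z hz => ?_⟩
  simp only [weighted, BoundedContinuousFunction.coe_ofNormedAddCommGroup, Real.coe_toNNReal z hz]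
  exact div_mul_cancel₀ _ (weight_pos z).ne'

theorem exists_isFixedPair {a P Q η : ℝ} (ha : |a - 1| ≤ 1 / 100000) (hP : |P - a| ≤ η)
    (hQ : |Q - a| ≤ η) (hη : η ≤ 2 / 100000) :
    ∃ p q f g, IsFixedPair (8 * η) a P Q p q f g := by
  have hη0 : 0 ≤ η := (abs_nonneg _).trans hP
  have hM : 0 ≤ 8 * η := by positivity
  have hM' : 8 * η ≤ 1 / 1000 := by linarith
  let X := BoundedContinuousFunction ℝ≥0 ℝ
  -- The radius 8η is the bound of `abs_normalizedDecay_le`, so the ball is mapped into itself.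
  let K : Set (X × X) := Metric.closedBall 0 (8 * η)
  have hK : ∀ x : K, ‖x.1.1‖ ≤ 8 * η ∧ ‖x.1.2‖ ≤ 8 * η := fun x => by
    have := mem_closedBall_zero_iff.1 x.2
    exact ⟨(norm_fst_le _).trans this, (norm_snd_le _).trans this⟩
  let pr : X → ℝ → ℝ := fun F z => a + ∫ t in (0 : ℝ)..z, weighted F t
  have bd : ∀ {F : X}, ‖F‖ ≤ 8 * η → ∀ z, 0 ≤ z → |weighted F z| ≤ 8 * η * weight z :=
    fun hF z _ => abs_weighted_le hF z
  have near : ∀ {F G : X}, ‖F‖ ≤ 8 * η → ‖G‖ ≤ 8 * η → NearOne (pr F) (pr G) (weighted G) :=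
    fun {F G} hF hG => nearOne_of_abs_le_weight hM hM' ha (continuous_weighted F).continuousOn
      (continuous_weighted G).continuousOn (fun _ _ => rfl) (fun _ _ => rfl) (bd hF) (bd hG)
  have step : ∀ {c : ℝ} {F G : X}, |c| ≤ η → ‖F‖ ≤ 8 * η → ‖G‖ ≤ 8 * η → ∃ H : X, ‖H‖ ≤ 8 * η ∧
      ∀ z, 0 ≤ z → weighted H z = normalizedDecay c (pr F) (pr G) (weighted G) z :=
    fun {c F G} hc hF hG => exists_weighted_eq hM ((near hF hG).continuousOn_normalizedDecay c)
      fun z hz => ((near hF hG).abs_normalizedDecay_le c hz).trans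
        (mul_le_mul_of_nonneg_right (by linarith) (weight_pos z).le)
  have hT : ∀ x : K, ∃ y : K,
      (∀ z, 0 ≤ z → weighted y.1.1 z =
        normalizedDecay (P - a) (pr x.1.1) (pr x.1.2) (weighted x.1.2) z) ∧
      ∀ z, 0 ≤ z → weighted y.1.2 z =
        normalizedDecay (Q - a) (pr x.1.2) (pr x.1.1) (weighted x.1.1) z := fun x => by
    obtain ⟨H, nH, eH⟩ := step hP (hK x).1 (hK x).2
    obtain ⟨L, nL, eL⟩ := step hQ (hK x).2 (hK x).1
    exact ⟨⟨(H, L), mem_closedBall_zero_iff.2 (max_le nH nL)⟩, eH, eL⟩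
  choose T hT1 hT2 using hT
  have hdist : ∀ {c : ℝ} {F G F' G' H H' : X} {D : ℝ}, 0 ≤ D → |c| ≤ η → ‖F‖ ≤ 8 * η →
      ‖G‖ ≤ 8 * η → ‖F'‖ ≤ 8 * η → ‖G'‖ ≤ 8 * η → dist F F' ≤ D → dist G G' ≤ D →
      (∀ z, 0 ≤ z → weighted H z = normalizedDecay c (pr F) (pr G) (weighted G) z) →
      (∀ z, 0 ≤ z → weighted H' z = normalizedDecay c (pr F') (pr G') (weighted G') z) →
      dist H H' ≤ D / 2 := by
    intro c F G F' G' H H' D hD hc nF nG nF' nG' dF dG eH eH'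
    refine (BoundedContinuousFunction.dist_le (by positivity)).2 fun x => ?_
    have hw : ∀ (A B : X), dist A B ≤ D → ∀ z, 0 ≤ z →
        |weighted A z - weighted B z| ≤ D * weight z := fun A B hAB z _ =>
      (abs_weighted_sub_le A B z).trans (mul_le_mul_of_nonneg_right hAB (weight_pos z).le)
    have h1 := abs_normalizedDecay_sub_le_half (a := a) (z := x) hD (hc.trans hη) (near nF nG)
      (near nF' nG') (continuous_weighted F).continuousOn (continuous_weighted F').continuousOn
      (fun _ _ => rfl) (fun _ _ => rfl) (fun _ _ => rfl) (fun _ _ => rfl)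
      (fun t ht => (bd nG' t ht).trans (mul_le_mul_of_nonneg_right hM' (weight_pos t).le))
      (hw F F' dF) (hw G G' dG) x.2
    rw [← eH x x.2, ← eH' x x.2] at h1
    unfold weighted at h1
    rw [← sub_mul, abs_mul, abs_of_pos (weight_pos _), Real.toNNReal_coe] at h1
    exact le_of_mul_le_mul_right h1 (weight_pos _)
  have hcontr : ContractingWith (1 / 2) T := by
    refine ⟨by norm_num, LipschitzWith.of_dist_le_mul fun x y => ?_⟩
    have d1 : dist x.1.1 y.1.1 ≤ dist x y := le_max_left _ _
    have d2 : dist x.1.2 y.1.2 ≤ dist x y := le_max_right _ _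
    have e1 := hdist dist_nonneg hP (hK x).1 (hK x).2 (hK y).1 (hK y).2 d1 d2 (hT1 x) (hT1 y)
    have e2 := hdist dist_nonneg hQ (hK x).2 (hK x).1 (hK y).2 (hK y).1 d2 d1 (hT2 x) (hT2 y)
    have : dist (T x) (T y) ≤ dist x y / 2 := max_le e1 e2
    refine this.trans_eq ?_
    push_cast
    ring
  have : CompleteSpace K := Metric.isClosed_closedBall.completeSpace_coe
  have : Nonempty K := ⟨⟨0, Metric.mem_closedBall_self hM⟩⟩
  obtain ⟨x, hx⟩ : ∃ x, T x = x := ⟨_, hcontr.fixedPoint_isFixedPt⟩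
  refine ⟨pr x.1.1, pr x.1.2, weighted x.1.1, weighted x.1.2,
    (continuous_weighted _).continuousOn, (continuous_weighted _).continuousOn,
    fun _ _ => rfl, fun _ _ => rfl, bd (hK x).1, bd (hK x).2, ?_, ?_⟩
  · have := hT1 x
    rwa [hx] at this
  · have := hT2 x
    rwa [hx] at this

/-! ### Families of functions with uniformly controlled derivatives -/

section Families

variable {ι : Type*}

/-- Polynomial growth, uniformly over the family. -/
def PolyBdd (h : ι → ℝ → ℝ) : Prop :=
  ∃ K : ℝ, 0 ≤ K ∧ ∃ N : ℕ, ∀ i z, 0 ≤ z → |h i z| ≤ K * (1 + z) ^ N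

/-- Decay faster than every power, of size `e i`, uniformly over the family. -/
def RapidDecay (e : ι → ℝ) (h : ι → ℝ → ℝ) : Prop :=
  ∀ m : ℕ, ∃ K : ℝ, 0 ≤ K ∧ ∀ i z, 0 ≤ z → (1 + z) ^ m * |h i z| ≤ K * e i

/-- The family and its one-sided derivatives of order up to `n` satisfy the bound `B`. -/
def DerivBound (B : (ι → ℝ → ℝ) → Prop) : ℕ → (ι → ℝ → ℝ) → Prop
  | 0, h => B h
  | n + 1, h => B h ∧ ∃ h' : ι → ℝ → ℝ,
      (∀ i z, 0 ≤ z → HasDerivWithinAt (h i) (h' i z) (Ici 0) z) ∧ DerivBound B n h'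

theorem PolyBdd.add {h₁ h₂ : ι → ℝ → ℝ} (b₁ : PolyBdd h₁) (b₂ : PolyBdd h₂) :
    PolyBdd fun i z => h₁ i z + h₂ i z := by
  obtain ⟨K, hK, N, b⟩ := b₁
  obtain ⟨L, hL, M, d⟩ := b₂
  refine ⟨K + L, by positivity, N + M, fun i z hz => (abs_add_le _ _).trans ?_⟩
  have h1 : (1 + z) ^ N ≤ (1 + z) ^ (N + M) := pow_le_pow_right₀ (by linarith) (by omega)
  have h2 : (1 + z) ^ M ≤ (1 + z) ^ (N + M) := pow_le_pow_right₀ (by linarith) (by omega)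
  calc _ ≤ K * (1 + z) ^ N + L * (1 + z) ^ M := add_le_add (b i z hz) (d i z hz)
    _ ≤ K * (1 + z) ^ (N + M) + L * (1 + z) ^ (N + M) := by gcongr
    _ = _ := by ring

theorem PolyBdd.mul {h₁ h₂ : ι → ℝ → ℝ} (b₁ : PolyBdd h₁) (b₂ : PolyBdd h₂) :
    PolyBdd fun i z => h₁ i z * h₂ i z := by
  obtain ⟨K, hK, N, b⟩ := b₁
  obtain ⟨L, hL, M, d⟩ := b₂
  refine ⟨K * L, by positivity, N + M, fun i z hz => ?_⟩
  rw [abs_mul]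
  calc _ ≤ (K * (1 + z) ^ N) * (L * (1 + z) ^ M) :=
        mul_le_mul (b i z hz) (d i z hz) (abs_nonneg _) (by positivity)
    _ = _ := by ring

theorem polyBdd_of_abs_le {h : ι → ℝ → ℝ} {K : ℝ} (b : ∀ i z, 0 ≤ z → |h i z| ≤ K) :
    PolyBdd h :=
  ⟨|K|, abs_nonneg _, 0, fun i z hz => by simpa using (b i z hz).trans (le_abs_self K)⟩

theorem RapidDecay.add {e : ι → ℝ} {h₁ h₂ : ι → ℝ → ℝ} (b₁ : RapidDecay e h₁)
    (b₂ : RapidDecay e h₂) : RapidDecay e fun i z => h₁ i z + h₂ i z := by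
  intro m
  obtain ⟨K, hK, b⟩ := b₁ m
  obtain ⟨L, hL, d⟩ := b₂ m
  refine ⟨K + L, by positivity, fun i z hz => ?_⟩
  calc _ ≤ (1 + z) ^ m * (|h₁ i z| + |h₂ i z|) := by
        gcongr
        exact abs_add_le _ _
    _ ≤ _ := by linarith [b i z hz, d i z hz]

theorem PolyBdd.mul_rapidDecay {e : ι → ℝ} {h₁ h₂ : ι → ℝ → ℝ} (b₁ : PolyBdd h₁)
    (b₂ : RapidDecay e h₂) : RapidDecay e fun i z => h₁ i z * h₂ i z := by
  intro m
  obtain ⟨K, hK, N, b⟩ := b₁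
  obtain ⟨L, hL, d⟩ := b₂ (m + N)
  refine ⟨K * L, by positivity, fun i z hz => ?_⟩
  rw [abs_mul]
  calc _ ≤ (1 + z) ^ m * (K * (1 + z) ^ N * |h₂ i z|) := by
        gcongr
        exact b i z hz
    _ = K * ((1 + z) ^ (m + N) * |h₂ i z|) := by ring
    _ ≤ K * (L * e i) := mul_le_mul_of_nonneg_left (d i z hz) hK
    _ = _ := by ring

theorem RapidDecay.congr {e : ι → ℝ} {h₁ h₂ : ι → ℝ → ℝ} (b : RapidDecay e h₁)
    (h : ∀ i, EqOn (h₁ i) (h₂ i) (Ici 0)) : RapidDecay e h₂ := fun m => by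
  obtain ⟨K, hK, b⟩ := b m
  exact ⟨K, hK, fun i z hz => by rw [← h i (mem_Ici.2 hz)]; exact b i z hz⟩

theorem exists_pow_mul_weight_le (m : ℕ) :
    ∃ K : ℝ, 0 ≤ K ∧ ∀ z, 0 ≤ z → (1 + z) ^ m * weight z ≤ K := by
  refine ⟨Real.exp (2 * m ^ 2), (Real.exp_pos _).le, fun z hz => ?_⟩
  have h1 : (1 + z) ^ m ≤ Real.exp z ^ m := by
    gcongr
    linarith [Real.add_one_le_exp z]
  calc _ ≤ Real.exp z ^ m * weight z := mul_le_mul_of_nonneg_right h1 (weight_pos z).le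
    _ = Real.exp (m * z + -z ^ 2 / 8) := by rw [← Real.exp_nat_mul, weight, ← Real.exp_add]
    _ ≤ _ := Real.exp_le_exp.2 (by nlinarith [sq_nonneg (z - 4 * m)])

theorem rapidDecay_of_abs_le_weight {e : ι → ℝ} {h : ι → ℝ → ℝ} {K : ℝ} (hK : 0 ≤ K)
    (he : ∀ i, 0 ≤ e i) (b : ∀ i z, 0 ≤ z → |h i z| ≤ K * e i * weight z) : RapidDecay e h := by
  intro m
  obtain ⟨L, hL, d⟩ := exists_pow_mul_weight_le m
  refine ⟨K * L, by positivity, fun i z hz => ?_⟩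
  have := he i
  calc _ ≤ (1 + z) ^ m * (K * e i * weight z) := by
        gcongr
        exact b i z hz
    _ = K * e i * ((1 + z) ^ m * weight z) := by ring
    _ ≤ K * e i * L := mul_le_mul_of_nonneg_left (d z hz) (by positivity)
    _ = _ := by ring

/-- Integration from infinity by comparison: K e (1 + y)^(-(m+1)) ∓ h is nonincreasing and tends to
0, hence is nonnegative. -/
theorem rapidDecay_of_deriv {e : ι → ℝ} {h h' : ι → ℝ → ℝ}
    (hd : ∀ i z, 0 ≤ z → HasDerivWithinAt (h i) (h' i z) (Ici 0) z)
    (hl : ∀ i, Tendsto (h i) atTop (𝓝 0)) (b : RapidDecay e h') : RapidDecay e h := by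
  have key : ∀ m : ℕ, ∃ K : ℝ, 0 ≤ K ∧
      ∀ i z, 0 ≤ z → (1 + z) ^ (m + 1) * |h i z| ≤ K * e i := by
    intro m
    -- One power is lost in integration; the constant survives because m + 1 ≥ 1.
    obtain ⟨K, hK, b⟩ := b (m + 2)
    refine ⟨K, hK, fun i z hz => ?_⟩
    have hpow : ∀ y : ℝ, 0 ≤ y → HasDerivWithinAt (fun y => K * e i * ((1 + y) ^ (m + 1))⁻¹)
        (K * e i * (-((m + 1) * (1 + y) ^ m) / ((1 + y) ^ (m + 1)) ^ 2)) (Ici 0) y := by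
      intro y hy
      have h1 : HasDerivAt (fun y : ℝ => (1 + y) ^ (m + 1)) ((m + 1) * (1 + y) ^ m) y := by
        have := ((hasDerivAt_id y).const_add 1).pow (m + 1)
        exact this.congr_deriv (by simp)
      exact ((h1.inv (by positivity)).const_mul _).hasDerivWithinAt
    have hKe : 0 ≤ K * e i := le_trans (by positivity) (b i 0 le_rfl)
    have hle : ∀ y : ℝ, 0 ≤ y →
        K * e i * (-((m + 1) * (1 + y) ^ m) / ((1 + y) ^ (m + 1)) ^ 2) ≤ -|h' i y| := by
      intro y hy
      have h0 : (0 : ℝ) < (1 + y) ^ (m + 2) := by positivity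
      have h1 : |h' i y| ≤ K * e i / (1 + y) ^ (m + 2) := by
        rw [le_div_iff₀ h0]
        linarith [b i y hy]
      have h2 : K * e i * (-((m + 1) * (1 + y) ^ m) / ((1 + y) ^ (m + 1)) ^ 2)
          = -((m + 1) * (K * e i / (1 + y) ^ (m + 2))) := by
        field_simp
        ring
      rw [h2, neg_le_neg_iff]
      have h3 : 0 ≤ K * e i / (1 + y) ^ (m + 2) := by positivity
      have h4 : (0 : ℝ) ≤ m := Nat.cast_nonneg m
      nlinarith
    have hlim : Tendsto (fun y : ℝ => K * e i * ((1 + y) ^ (m + 1))⁻¹) atTop (𝓝 0) := by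
      have h1 : Tendsto (fun y : ℝ => (1 + y) ^ (m + 1)) atTop atTop :=
        (tendsto_pow_atTop (by omega)).comp (tendsto_atTop_add_const_left _ _ tendsto_id)
      simpa using (h1.inv_tendsto_atTop).const_mul (K * e i)
    have main : ∀ {k k' : ℝ → ℝ}, (∀ y, 0 ≤ y → HasDerivWithinAt k (k' y) (Ici 0) y) →
        Tendsto k atTop (𝓝 0) → (∀ y, |k' y| = |h' i y|) →
        k z ≤ K * e i * ((1 + z) ^ (m + 1))⁻¹ := by
      intro k k' hk hkl hkk
      have hder : ∀ y, 0 ≤ y → HasDerivWithinAt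
          (fun y => K * e i * ((1 + y) ^ (m + 1))⁻¹ - k y)
          (K * e i * (-((m + 1) * (1 + y) ^ m) / ((1 + y) ^ (m + 1)) ^ 2) - k' y) (Ici 0) y :=
        fun y hy => (hpow y hy).sub (hk y hy)
      have hanti : AntitoneOn (fun y => K * e i * ((1 + y) ^ (m + 1))⁻¹ - k y) (Ici 0) := by
        refine antitoneOn_of_hasDerivWithinAt_nonpos (convex_Ici 0)
          (fun y hy => (hder y hy).continuousWithinAt)
          (fun y hy => (hder y (interior_subset hy)).mono interior_subset) fun y hy => ?_
        have h1 := hle y (interior_subset hy)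
        rw [← hkk y] at h1
        linarith [neg_abs_le (k' y)]
      have hl0 := hlim.sub hkl
      rw [sub_zero] at hl0
      have := le_of_tendsto hl0 <| by
        filter_upwards [eventually_ge_atTop z] with y hy
        exact hanti hz (hz.trans hy) hy
      linarith
    have h1 := main (hd i) (hl i) fun _ => rfl
    have h2 := main (k := fun y => -h i y) (fun y hy => (hd i y hy).neg)
      (by simpa using (hl i).neg) fun y => abs_neg _
    have h3 : |h i z| ≤ K * e i * ((1 + z) ^ (m + 1))⁻¹ := abs_le.2 ⟨by linarith, h1⟩
    have h0 : (0 : ℝ) < (1 + z) ^ (m + 1) := by positivity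
    rw [← div_eq_mul_inv, le_div_iff₀ h0] at h3
    linarith
  intro m
  obtain ⟨K, hK, b⟩ := key m
  refine ⟨K, hK, fun i z hz => (mul_le_mul_of_nonneg_right ?_ (abs_nonneg _)).trans (b i z hz)⟩
  exact pow_le_pow_right₀ (by linarith) (by omega)

namespace DerivBound

theorem of_succ {B : (ι → ℝ → ℝ) → Prop} {n : ℕ} {h : ι → ℝ → ℝ} (H : DerivBound B (n + 1) h) :
    DerivBound B n h := by
  induction n generalizing h with
  | zero => exact H.1
  | succ n ih =>
    obtain ⟨b, h', hd, H'⟩ := H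
    exact ⟨b, h', hd, ih H'⟩

theorem add {B : (ι → ℝ → ℝ) → Prop}
    (hB : ∀ {h₁ h₂}, B h₁ → B h₂ → B fun i z => h₁ i z + h₂ i z) {n : ℕ} {h₁ h₂ : ι → ℝ → ℝ}
    (H₁ : DerivBound B n h₁) (H₂ : DerivBound B n h₂) :
    DerivBound B n fun i z => h₁ i z + h₂ i z := by
  induction n generalizing h₁ h₂ with
  | zero => exact hB H₁ H₂
  | succ n ih =>
    obtain ⟨b₁, h₁', d₁, H₁'⟩ := H₁
    obtain ⟨b₂, h₂', d₂, H₂'⟩ := H₂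
    exact ⟨hB b₁ b₂, _, fun i z hz => (d₁ i z hz).add (d₂ i z hz), ih H₁' H₂'⟩

theorem mul {B₁ B₂ : (ι → ℝ → ℝ) → Prop}
    (hB : ∀ {h₁ h₂}, B₂ h₁ → B₂ h₂ → B₂ fun i z => h₁ i z + h₂ i z)
    (hB' : ∀ {h₁ h₂}, B₁ h₁ → B₂ h₂ → B₂ fun i z => h₁ i z * h₂ i z) {n : ℕ}
    {h₁ h₂ : ι → ℝ → ℝ} (H₁ : DerivBound B₁ n h₁) (H₂ : DerivBound B₂ n h₂) :
    DerivBound B₂ n fun i z => h₁ i z * h₂ i z := by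
  induction n generalizing h₁ h₂ with
  | zero => exact hB' H₁ H₂
  | succ n ih =>
    have H₁s := H₁.of_succ
    have H₂s := H₂.of_succ
    obtain ⟨b₁, h₁', d₁, H₁'⟩ := H₁
    obtain ⟨b₂, h₂', d₂, H₂'⟩ := H₂
    exact ⟨hB' b₁ b₂, _, fun i z hz => (d₁ i z hz).mul (d₂ i z hz),
      add hB (ih H₁' H₂s) (ih H₁s H₂')⟩

theorem const (n : ℕ) (c : ℝ) : DerivBound PolyBdd n fun (_ : ι) (_ : ℝ) => c := by
  induction n generalizing c with
  | zero => exact polyBdd_of_abs_le fun _ _ _ => le_rfl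
  | succ n ih =>
    exact ⟨polyBdd_of_abs_le fun _ _ _ => le_rfl, _,
      fun i z _ => hasDerivWithinAt_const z (Ici 0) c, ih 0⟩

theorem id (n : ℕ) : DerivBound PolyBdd n fun (_ : ι) (z : ℝ) => z := by
  have h0 : PolyBdd fun (_ : ι) (z : ℝ) => z :=
    ⟨1, zero_le_one, 1, fun _ z hz => by rw [abs_of_nonneg hz]; linarith⟩
  cases n with
  | zero => exact h0
  | succ n => exact ⟨h0, _, fun i z _ => hasDerivWithinAt_id z (Ici 0), const n 1⟩

theorem mul_poly {n : ℕ} {h₁ h₂ : ι → ℝ → ℝ} (H₁ : DerivBound PolyBdd n h₁)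
    (H₂ : DerivBound PolyBdd n h₂) : DerivBound PolyBdd n fun i z => h₁ i z * h₂ i z :=
  H₁.mul PolyBdd.add PolyBdd.mul H₂

theorem mul_rapid {e : ι → ℝ} {n : ℕ} {h₁ h₂ : ι → ℝ → ℝ} (H₁ : DerivBound PolyBdd n h₁)
    (H₂ : DerivBound (RapidDecay e) n h₂) :
    DerivBound (RapidDecay e) n fun i z => h₁ i z * h₂ i z :=
  H₁.mul RapidDecay.add PolyBdd.mul_rapidDecay H₂

theorem pow (n m : ℕ) : DerivBound PolyBdd n fun (_ : ι) (z : ℝ) => z ^ m := by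
  induction m with
  | zero => simpa using const (ι := ι) n 1
  | succ m ih => simpa only [pow_succ] using ih.mul_poly (id n)

theorem rapidDecay_hderiv {e : ι → ℝ} {n : ℕ} {h : ι → ℝ → ℝ}
    (H : DerivBound (RapidDecay e) n h) : RapidDecay e fun i => hderiv n (h i) := by
  induction n generalizing h with
  | zero => exact RapidDecay.congr H fun i z _ => by rw [hderiv_zero]
  | succ n ih =>
    obtain ⟨-, h', hd, H'⟩ := H
    exact (ih H').congr fun i => (hderiv_succ_of_hasDerivWithinAt (hd i) n).symm

/-- Only existence of derivatives is recorded in `DerivBound`, so continuity of the n-th one is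
drawn from the (n+1)-st. -/
theorem contDiffOn {B : (ι → ℝ → ℝ) → Prop} {n : ℕ} {h : ι → ℝ → ℝ}
    (H : DerivBound B (n + 1) h) (i : ι) : ContDiffOn ℝ n (h i) (Ici 0) := by
  induction n generalizing h with
  | zero =>
    obtain ⟨-, h', hd, -⟩ := H
    rw [Nat.cast_zero, contDiffOn_zero]
    exact fun z hz => (hd i z hz).continuousWithinAt
  | succ n ih =>
    obtain ⟨-, h', hd, H'⟩ := H
    exact contDiffOn_succ_of_hasDerivWithinAt (hd i) (ih H')

end DerivBound

/-! ### Uniform derivative bounds for the fronts and the solutions -/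

theorem derivBound_frontDeriv {e c : ι → ℝ} (hc : ∀ i, |c i| ≤ e i) (n : ℕ) :
    DerivBound (RapidDecay e) n fun i z => frontDeriv (c i) z := by
  have h0 : RapidDecay e fun i z => frontDeriv (c i) z := by
    refine rapidDecay_of_abs_le_weight zero_le_one (fun i => (abs_nonneg _).trans (hc i))
      fun i z _ => ?_
    have h1 : 1 ≤ Real.sqrt Real.pi := by
      rw [Real.one_le_sqrt]
      linarith [Real.pi_gt_three]
    have h2 : Real.exp (-z ^ 2 / 4) ≤ weight z :=
      Real.exp_le_exp.2 (by linarith [sq_nonneg z])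
    rw [frontDeriv, abs_mul, abs_div, abs_of_pos (Real.exp_pos _), one_mul,
      abs_of_pos (by linarith : 0 < Real.sqrt Real.pi)]
    exact mul_le_mul ((div_le_self (abs_nonneg _) h1).trans (hc i)) h2 (Real.exp_pos _).le
      ((abs_nonneg _).trans (hc i))
  induction n with
  | zero => exact h0
  | succ n ih =>
    refine ⟨h0, fun i z => -1 / 2 * z * frontDeriv (c i) z, fun i z _ => ?_,
      ((DerivBound.const n (-1 / 2)).mul_poly (DerivBound.id n)).mul_rapid ih⟩
    exact ((hasDerivAt_frontDeriv (c i) z).congr_deriv (by ring)).hasDerivWithinAt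

/-- The derivatives of p, q, f, g and (p + q)⁻¹ are polynomials in these five functions and z, so
all five are bounded together by induction on the order. -/
theorem derivBound_poly_of_isCharPair {a P Q : ι → ℝ} {p q f g : ι → ℝ → ℝ}
    (h : ∀ i, IsCharPair (a i) (P i) (Q i) (p i) (q i) (f i) (g i))
    (hn : ∀ i, NearOne (p i) (q i) (g i)) (bf : PolyBdd f) (bg : PolyBdd g) (n : ℕ) :
    DerivBound PolyBdd n p ∧ DerivBound PolyBdd n q ∧ DerivBound PolyBdd n f ∧
      DerivBound PolyBdd n g ∧ DerivBound PolyBdd n fun i z => (p i z + q i z)⁻¹ := by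
  have bp : PolyBdd p := polyBdd_of_abs_le (K := 2) fun i z hz => by
    have := abs_le.1 ((hn i).abs_fst z hz)
    exact abs_le.2 ⟨by linarith, by linarith⟩
  have bq : PolyBdd q := polyBdd_of_abs_le (K := 2) fun i z hz => by
    have := abs_le.1 ((hn i).abs_snd z hz)
    exact abs_le.2 ⟨by linarith, by linarith⟩
  have br : PolyBdd fun i z => (p i z + q i z)⁻¹ := polyBdd_of_abs_le (K := 1) fun i z hz => by
    have := abs_le.1 ((hn i).abs_fst z hz)
    have := abs_le.1 ((hn i).abs_snd z hz)
    have hs := (hn i).add_pos hz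
    rw [abs_of_pos (inv_pos.2 hs)]
    exact inv_le_one_of_one_le₀ (by linarith)
  induction n with
  | zero => exact ⟨bp, bq, bf, bg, br⟩
  | succ n ih =>
    obtain ⟨Hp, Hq, Hf, Hg, Hr⟩ := ih
    have key : ∀ {y k l : ι → ℝ → ℝ}, DerivBound PolyBdd n y → DerivBound PolyBdd n k →
        DerivBound PolyBdd n l → DerivBound PolyBdd n fun i z =>
          -1 * (2 * k i z * (p i z + q i z)⁻¹
            + 2 * z * y i z * ((p i z + q i z)⁻¹ * (p i z + q i z)⁻¹)) * l i z :=
      fun Hy Hk Hl => ((DerivBound.const n (-1)).mul_poly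
        ((((DerivBound.const n 2).mul_poly Hk).mul_poly Hr).add PolyBdd.add
          ((((DerivBound.const n 2).mul_poly (DerivBound.id n)).mul_poly Hy).mul_poly
            (Hr.mul_poly Hr)))).mul_poly Hl
    refine ⟨⟨bp, f, fun i => (h i).deriv_fst, Hf⟩, ⟨bq, g, fun i => (h i).deriv_snd, Hg⟩,
      ⟨bf, _, fun i z hz => ?_, key Hq Hg Hf⟩, ⟨bg, _, fun i z hz => ?_, key Hp Hf Hg⟩,
      ⟨br, _, fun i z hz => ?_, ((DerivBound.const n (-1)).mul_poly
        (Hf.add PolyBdd.add Hg)).mul_poly (Hr.mul_poly Hr)⟩⟩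
    · refine ((h i).hasDerivWithinAt_deriv_fst hz ((hn i).add_pos hz)).congr_deriv ?_
      simp only [drift, div_eq_mul_inv, pow_two, mul_inv]
      ring
    · refine ((h i).hasDerivWithinAt_deriv_snd hz ((hn i).add_pos hz)).congr_deriv ?_
      simp only [drift, div_eq_mul_inv, pow_two, mul_inv, add_comm (q i z) (p i z)]
      ring
    · refine ((((h i).deriv_fst z hz).add ((h i).deriv_snd z hz)).inv
        ((hn i).add_pos hz).ne').congr_deriv ?_
      simp only [div_eq_mul_inv, pow_two, mul_inv, Pi.add_apply]
      ring

/-- f' is a polynomially bounded coefficient times f, so each derivative inherits both the rapid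
decay of f and its size e. -/
theorem derivBound_rapid_of_isCharPair {e a P Q : ι → ℝ} {p q f g : ι → ℝ → ℝ}
    (h : ∀ i, IsCharPair (a i) (P i) (Q i) (p i) (q i) (f i) (g i))
    (hn : ∀ i, NearOne (p i) (q i) (g i)) (bf : PolyBdd f) (bg : PolyBdd g)
    (rf : RapidDecay e f) (n : ℕ) : DerivBound (RapidDecay e) n f := by
  induction n with
  | zero => exact rf
  | succ n ih =>
    obtain ⟨-, Hq, -, Hg, Hr⟩ := derivBound_poly_of_isCharPair h hn bf bg n
    refine ⟨rf, _, fun i z hz => ?_, ((DerivBound.const n (-1)).mul_poly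
        ((((DerivBound.const n 2).mul_poly Hg).mul_poly Hr).add PolyBdd.add
          ((((DerivBound.const n 2).mul_poly (DerivBound.id n)).mul_poly Hq).mul_poly
            (Hr.mul_poly Hr)))).mul_rapid ih⟩
    refine ((h i).hasDerivWithinAt_deriv_fst hz ((hn i).add_pos hz)).congr_deriv ?_
    simp only [drift, div_eq_mul_inv, pow_two, mul_inv]
    ring

end Families

/-! ### Norms -/

theorem hnorm_congr {p : ℝ≥0∞} {f g : ℝ → ℝ} (h : EqOn f g (Ici 0)) : hnorm p f = hnorm p g :=
  eLpNorm_congr_ae ((ae_restrict_mem measurableSet_Ici).mono h)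

theorem hnorm_mono {p : ℝ≥0∞} {f g : ℝ → ℝ} (h : ∀ z, 0 ≤ z → |f z| ≤ |g z|) :
    hnorm p f ≤ hnorm p g :=
  eLpNorm_mono_ae ((ae_restrict_mem measurableSet_Ici).mono h)

theorem hnorm_const_mul {p : ℝ≥0∞} {c : ℝ} (hc : 0 ≤ c) (f : ℝ → ℝ) :
    hnorm p (fun z => c * f z) = ENNReal.ofReal c * hnorm p f := by
  have := eLpNorm_const_smul c f p (volume.restrict (Ici (0 : ℝ)))
  rw [← ofReal_norm, Real.norm_of_nonneg hc] at this
  exact this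

theorem hnorm_inv_lt_top : hnorm 2 (fun z => (1 + z)⁻¹) < ⊤ := by
  have hm : AEStronglyMeasurable (fun z : ℝ => (1 + z)⁻¹) (volume.restrict (Ici 0)) :=
    (by fun_prop : Measurable fun z : ℝ => (1 + z)⁻¹).aestronglyMeasurable
  refine ((memLp_two_iff_integrable_sq hm).2 ?_).eLpNorm_lt_top
  refine Integrable.mono' integrable_inv_one_add_sq.integrableOn (hm.pow 2) ?_
  filter_upwards [ae_restrict_mem measurableSet_Ici] with z hz
  have hz : 0 ≤ z := hz
  rw [Real.norm_of_nonneg (by positivity), inv_pow]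
  gcongr
  nlinarith

/-- One power of decay suffices, as (1 + z)⁻¹ is square integrable on the half-line. -/
theorem exists_hnorm_le_of_rapidDecay {ι : Type*} {e : ι → ℝ} (he : ∀ i, 0 ≤ e i)
    {h : ι → ℝ → ℝ} (H : RapidDecay e h) :
    ∃ K : ℝ≥0, ∀ i, hnorm 2 (h i) ≤ K * ENNReal.ofReal (e i) := by
  obtain ⟨K, hK, b⟩ := H 1
  refine ⟨(ENNReal.ofReal K * hnorm 2 fun z => (1 + z)⁻¹).toNNReal, fun i => ?_⟩
  rw [ENNReal.coe_toNNReal (ENNReal.mul_ne_top ENNReal.ofReal_ne_top hnorm_inv_lt_top.ne)]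
  have hKe : 0 ≤ K * e i := mul_nonneg hK (he i)
  calc hnorm 2 (h i) ≤ hnorm 2 (fun z => K * e i * (1 + z)⁻¹) := hnorm_mono fun z hz => by
        have h0 : 0 < 1 + z := by linarith
        rw [abs_of_nonneg (by positivity : 0 ≤ K * e i * (1 + z)⁻¹), ← div_eq_mul_inv,
          le_div_iff₀ h0]
        linarith [b i z hz]
    _ = ENNReal.ofReal K * ENNReal.ofReal (e i) * hnorm 2 (fun z => (1 + z)⁻¹) := by
        rw [hnorm_const_mul hKe, ENNReal.ofReal_mul hK]
    _ = _ := by ring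

theorem exists_sum_sq_rpow_le {ι κ : Type*} (s : Finset κ) {E : ι → ℝ≥0∞} {a : κ → ι → ℝ≥0∞}
    (h : ∀ k ∈ s, ∃ K : ℝ≥0, ∀ i, a k i ≤ K * E i) :
    ∃ K : ℝ≥0, ∀ i, (∑ k ∈ s, a k i ^ 2) ^ (1 / 2 : ℝ) ≤ K * E i := by
  choose! K hK using h
  refine ⟨∑ k ∈ s, K k, fun i => ?_⟩
  have h1 : ∑ k ∈ s, a k i ^ 2 ≤ (((∑ k ∈ s, K k : ℝ≥0) : ℝ≥0∞) * E i) ^ 2 := by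
    push_cast
    calc ∑ k ∈ s, a k i ^ 2 ≤ (∑ k ∈ s, a k i) ^ 2 := by
          simp only [sq, Finset.sum_mul]
          gcongr with k hk
          exact Finset.single_le_sum (f := fun k => a k i) (fun _ _ => zero_le) hk
      _ ≤ (∑ k ∈ s, K k * E i) ^ 2 := by
          gcongr with k hk
          exact hK k hk i
      _ = _ := by rw [Finset.sum_mul]
  calc _ ≤ ((((∑ k ∈ s, K k : ℝ≥0) : ℝ≥0∞) * E i) ^ 2) ^ (1 / 2 : ℝ) := by gcongr
    _ = _ := by
      rw [← ENNReal.rpow_natCast, ← ENNReal.rpow_mul]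
      norm_num

theorem exists_sobolevNorm_le {ι : Type*} {e : ι → ℝ} (he : ∀ i, 0 ≤ e i) {φ ψ : ι → ℝ → ℝ}
    (hφ : ∀ n, DerivBound (RapidDecay e) n φ) (hψ : ∀ n, DerivBound (RapidDecay e) n ψ)
    (m k : ℕ) : ∃ K : ℝ≥0, ∀ i, sobolevNorm k (fun z => z ^ m * φ i z) (fun z => z ^ m * ψ i z)
      ≤ K * ENNReal.ofReal (e i) := by
  have key : ∀ {χ : ι → ℝ → ℝ}, (∀ n, DerivBound (RapidDecay e) n χ) → ∀ j, ∃ K : ℝ≥0, ∀ i,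
      hnorm 2 (hderiv j fun z => z ^ m * χ i z) ≤ K * ENNReal.ofReal (e i) := fun hχ j =>
    exists_hnorm_le_of_rapidDecay he ((DerivBound.pow j m).mul_rapid (hχ j)).rapidDecay_hderiv
  -- The Boolean selects the component of the pair, making the double sum a single one.
  obtain ⟨K, hK⟩ := exists_sum_sq_rpow_le (Finset.range (k + 1) ×ˢ (Finset.univ : Finset Bool))
    (E := fun i => ENNReal.ofReal (e i))
    (a := fun x i => hnorm 2 (hderiv x.1 fun z => z ^ m * (bif x.2 then φ i z else ψ i z)))
    fun x _ => by
      cases x.2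
      · exact key hψ x.1
      · exact key hφ x.1
  refine ⟨K, fun i => ?_⟩
  have := hK i
  rwa [Finset.sum_product, Finset.sum_congr rfl fun j _ => Fintype.sum_bool _] at this

theorem exists_hwNorm_le {ι : Type*} {e : ι → ℝ} (he : ∀ i, 0 ≤ e i) {φ ψ : ι → ℝ → ℝ}
    (hφ : ∀ n, DerivBound (RapidDecay e) n φ) (hψ : ∀ n, DerivBound (RapidDecay e) n ψ) :
    ∃ K : ℝ≥0, ∀ i, hwNorm (φ i) (ψ i) ≤ K * ENNReal.ofReal (e i) := by
  have b1 : PolyBdd fun (_ : ι) (z : ℝ) => 1 + z :=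
    ⟨1, zero_le_one, 1, fun _ z hz => by rw [abs_of_nonneg (by linarith)]; linarith⟩
  have key : ∀ {χ : ι → ℝ → ℝ}, (∀ n, DerivBound (RapidDecay e) n χ) →
      (∃ K : ℝ≥0, ∀ i, hnorm 2 (hderiv 2 (χ i)) ≤ K * ENNReal.ofReal (e i)) ∧
      (∃ K : ℝ≥0, ∀ i, hnorm 2 (fun z => (1 + z) * hderiv 1 (χ i) z)
        ≤ K * ENNReal.ofReal (e i)) ∧
      ∃ K : ℝ≥0, ∀ i, hnorm 2 (fun z => (1 + z) * χ i z) ≤ K * ENNReal.ofReal (e i) := fun hχ =>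
    ⟨exists_hnorm_le_of_rapidDecay he (hχ 2).rapidDecay_hderiv,
      exists_hnorm_le_of_rapidDecay he (b1.mul_rapidDecay (hχ 1).rapidDecay_hderiv),
      exists_hnorm_le_of_rapidDecay he (b1.mul_rapidDecay (hχ 0))⟩
  obtain ⟨a1, a2, a3⟩ := key hφ
  obtain ⟨c1, c2, c3⟩ := key hψ
  obtain ⟨K, hK⟩ := exists_sum_sq_rpow_le (Finset.univ : Finset (Fin 6))
    (E := fun i => ENNReal.ofReal (e i))
    (a := ![fun i => hnorm 2 (hderiv 2 (φ i)),
      fun i => hnorm 2 (fun z => (1 + z) * hderiv 1 (φ i) z),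
      fun i => hnorm 2 (fun z => (1 + z) * φ i z), fun i => hnorm 2 (hderiv 2 (ψ i)),
      fun i => hnorm 2 (fun z => (1 + z) * hderiv 1 (ψ i) z),
      fun i => hnorm 2 (fun z => (1 + z) * ψ i z)])
    fun x _ => by fin_cases x <;> assumption
  refine ⟨K, fun i => ?_⟩
  refine le_trans (le_of_eq ?_) (hK i)
  rw [hwNorm, hwSq, hwSq, Fin.sum_univ_six]
  simp only [← add_assoc]
  rfl

/-! ### Lower bounds for the size of the fronts -/

theorem front_eq_mul (c z : ℝ) : front c z = c * front 1 z := by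
  unfold front; ring

theorem strictMono_front_one : StrictMono (front 1) := by
  refine strictMono_of_deriv_pos fun z => ?_
  rw [(hasDerivAt_front 1 z).deriv]
  have := Real.pi_pos
  unfold frontDeriv
  positivity

theorem front_one_lt_one (z : ℝ) : front 1 z < 1 :=
  (strictMono_front_one (lt_add_one z)).trans_le
    (strictMono_front_one.monotone.ge_of_tendsto (tendsto_front 1) _)

theorem continuous_front (c : ℝ) : Continuous (front c) :=
  continuous_iff_continuousAt.2 fun z => (hasDerivAt_front c z).continuousAt

/-- Replacing N by min N 1 makes it invertible even when it is infinite, so the norms of the unit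
fronts need only be nonzero. -/
theorem exists_le_mul_of_mul_le {N : ℝ≥0∞} (hN : N ≠ 0) :
    ∃ C : ℝ≥0, ∀ x y : ℝ≥0∞, x * N ≤ y → x ≤ C * y := by
  have h0 : min N 1 ≠ 0 := by simp [hN]
  have h1 : min N 1 ≠ ⊤ := ne_top_of_le_ne_top ENNReal.one_ne_top (min_le_right _ _)
  refine ⟨(min N 1)⁻¹.toNNReal, fun x y h => ?_⟩
  rw [ENNReal.coe_toNNReal (ENNReal.inv_ne_top.2 h0)]
  calc x = (min N 1)⁻¹ * (x * min N 1) := by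
        rw [mul_comm x, ← mul_assoc, ENNReal.inv_mul_cancel h0 h1, one_mul]
    _ ≤ (min N 1)⁻¹ * y := by
        gcongr
        exact le_trans (by gcongr; exact min_le_left _ _) h

theorem hnorm_ne_zero {p : ℝ≥0∞} (hp : p ≠ 0) {f : ℝ → ℝ}
    (hf : AEStronglyMeasurable f (volume.restrict (Ici 0))) {S : Set ℝ} (hS : volume S ≠ 0)
    (hS0 : S ⊆ Ici 0) (h : ∀ z ∈ S, f z ≠ 0) : hnorm p f ≠ 0 := by
  intro h0
  rw [hnorm, eLpNorm_eq_zero_iff hf hp, Filter.EventuallyEq, ae_restrict_iff' measurableSet_Ici]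
    at h0
  refine hS (measure_mono_null (fun z hz => ?_) (ae_iff.1 h0))
  simp only [mem_ofPred_eq, Classical.not_imp]
  exact ⟨hS0 hz, h z hz⟩

theorem exists_le_frontSize : ∃ C : ℝ≥0, ∀ (l : ℕ) (δ σ : ℝ), 0 ≤ δ → 0 ≤ σ →
    ENNReal.ofReal (δ + σ) ≤ C * frontSize l δ σ := by
  have hS : volume (Icc (1 : ℝ) 2) ≠ 0 := by simp
  have hS0 : Icc (1 : ℝ) 2 ⊆ Ici 0 := fun z hz => zero_le_one.trans hz.1
  have n1 : hnorm ⊤ (front 1) ≠ 0 :=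
    hnorm_ne_zero (by simp) (continuous_front 1).aestronglyMeasurable hS hS0 fun z hz => by
      have : front 1 0 < front 1 z := strictMono_front_one (by linarith [hz.1])
      rw [front_zero] at this
      exact this.ne'
  -- Restriction to [1, 2], where z^l ≥ 1, makes the constant independent of l.
  have n2 : hnorm ⊤ (indicator (Icc 1 2) fun z => front 1 z - 1) ≠ 0 :=
    hnorm_ne_zero (by simp) ((((continuous_front 1).sub
      continuous_const).aestronglyMeasurable).indicator measurableSet_Icc) hS hS0 fun z hz => by
      rw [indicator_of_mem hz]
      exact (sub_neg.2 (front_one_lt_one z)).ne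
  obtain ⟨C₁, h₁⟩ := exists_le_mul_of_mul_le n1
  obtain ⟨C₂, h₂⟩ := exists_le_mul_of_mul_le n2
  refine ⟨C₂ + C₁, fun l δ σ hδ hσ => ?_⟩
  rw [ENNReal.ofReal_add hδ hσ]
  push_cast
  rw [add_mul]
  refine add_le_add (h₂ _ _ ?_) (h₁ _ _ ?_)
  · rw [← hnorm_const_mul hδ]
    refine le_trans (hnorm_mono fun z hz => ?_)
      ((le_max_right (hnorm ⊤ (front σ)) _).trans (le_max_left _ _))
    by_cases hz' : z ∈ Icc (1 : ℝ) 2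
    · rw [indicator_of_mem hz', front_eq_mul δ z,
        show δ * front 1 z - δ = δ * (front 1 z - 1) by ring, abs_mul (z ^ l)]
      refine le_mul_of_one_le_left (abs_nonneg _) ?_
      rw [abs_of_nonneg (by positivity)]
      exact one_le_pow₀ hz'.1
    · rw [indicator_of_notMem hz', mul_zero, abs_zero]
      exact abs_nonneg _
  · rw [← hnorm_const_mul hσ, ← hnorm_congr fun z _ => front_eq_mul σ z]
    exact (le_max_left _ _).trans (le_max_left _ _)

/-- Each differentiation replaces the polynomial factor p by p' - z p / 2, whose degree is one
higher, so it never becomes zero. -/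
theorem exists_polynomial_hderiv_frontDeriv (k : ℕ) :
    ∃ p : Polynomial ℝ, p ≠ 0 ∧
      ∀ z, 0 ≤ z → hderiv k (frontDeriv 1) z = p.eval z * Real.exp (-z ^ 2 / 4) := by
  have hpi : 1 / Real.sqrt Real.pi ≠ 0 :=
    one_div_ne_zero (Real.sqrt_pos.2 Real.pi_pos).ne'
  have hexp : ∀ z : ℝ, HasDerivAt (fun z : ℝ => Real.exp (-z ^ 2 / 4))
      (-(z / 2) * Real.exp (-z ^ 2 / 4)) z := fun z => by
    have h := (hasDerivAt_frontDeriv (Real.sqrt Real.pi) z)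
    have e : frontDeriv (Real.sqrt Real.pi) = fun z => Real.exp (-z ^ 2 / 4) := by
      ext y
      rw [frontDeriv, div_self (Real.sqrt_pos.2 Real.pi_pos).ne', one_mul]
    rwa [e] at h
  have key : ∀ (k : ℕ) (p : Polynomial ℝ), p ≠ 0 → ∃ r : Polynomial ℝ, r ≠ 0 ∧
      ∀ z, 0 ≤ z → hderiv k (fun z => p.eval z * Real.exp (-z ^ 2 / 4)) z
        = r.eval z * Real.exp (-z ^ 2 / 4) := by
    intro k
    induction k with
    | zero => exact fun p hp => ⟨p, hp, fun z _ => by rw [hderiv_zero]⟩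
    | succ k ih =>
      intro p hp
      have hd : ∀ z, 0 ≤ z → HasDerivWithinAt (fun z => p.eval z * Real.exp (-z ^ 2 / 4))
          ((Polynomial.derivative p - Polynomial.C (1 / 2) * (Polynomial.X * p)).eval z
            * Real.exp (-z ^ 2 / 4)) (Ici 0) z := fun z _ => by
        refine (((p.hasDerivAt z).mul (hexp z)).congr_deriv ?_).hasDerivWithinAt
        simp only [Polynomial.eval_sub, Polynomial.eval_mul, Polynomial.eval_C, Polynomial.eval_X]
        ring
      have hne : Polynomial.derivative p - Polynomial.C (1 / 2) * (Polynomial.X * p) ≠ 0 := by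
        intro h0
        have h1 := congrArg Polynomial.degree (sub_eq_zero.1 h0)
        rw [Polynomial.degree_C_mul (by norm_num : (1 / 2 : ℝ) ≠ 0), Polynomial.degree_mul,
          Polynomial.degree_X] at h1
        have h2 := Polynomial.degree_derivative_lt hp
        rw [h1, Polynomial.degree_eq_natDegree hp] at h2
        have h3 : 1 + p.natDegree < p.natDegree := by exact_mod_cast h2
        omega
      obtain ⟨r, hr, hr'⟩ := ih _ hne
      exact ⟨r, hr, fun z hz => (hderiv_succ_of_hasDerivWithinAt hd k hz).trans (hr' z hz)⟩
  obtain ⟨r, hr, hr'⟩ := key k (Polynomial.C (1 / Real.sqrt Real.pi))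
    (Polynomial.C_ne_zero.2 hpi)
  refine ⟨r, hr, fun z hz => ?_⟩
  rw [← hr' z hz]
  refine hderiv_congr (fun y _ => ?_) k hz
  simp only [Polynomial.eval_C, frontDeriv]

theorem hderiv_front_sub (δ : ℝ) (k : ℕ) (z : ℝ) :
    hderiv k (fun y => front δ y - δ) z = δ * hderiv k (fun y => front 1 y - 1) z := by
  have e : (fun y => front δ y - δ) = fun y => δ * (front 1 y - 1) := by
    ext y
    rw [front_eq_mul]
    ring
  rw [e]
  exact iteratedDerivWithin_const_mul_field _ _

/-- e_δ - δ = δ (e_1 - 1), and the k-th derivative of e_1 - 1 vanishes at most on a null set: for k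
= 0 because e_1 < 1, otherwise because it is a nonzero polynomial times a Gaussian. The σ/2 in R
handles σ. -/
theorem exists_le_frontSizeAt (m k : ℕ) : ∃ C : ℝ≥0, ∀ δ σ : ℝ, 0 ≤ δ → 0 ≤ σ →
    ENNReal.ofReal (δ + σ) ≤ C * frontSizeAt m k δ σ := by
  have hn : hnorm 2 (fun z => z ^ m * hderiv k (fun y => front 1 y - 1) z) ≠ 0 := by
    cases k with
    | zero =>
      simp only [hderiv_zero]
      refine hnorm_ne_zero (by simp) (((continuous_pow m).mul
        ((continuous_front 1).sub continuous_const)).aestronglyMeasurable) (S := Ioi 0) (by simp)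
        Ioi_subset_Ici_self fun z hz => ?_
      exact mul_ne_zero (pow_ne_zero m (ne_of_gt hz)) (sub_neg.2 (front_one_lt_one z)).ne
    | succ k =>
      obtain ⟨p, hp, hp'⟩ := exists_polynomial_hderiv_frontDeriv k
      have h1 : ∀ z, 0 ≤ z →
          HasDerivWithinAt (fun y => front 1 y - 1) (frontDeriv 1 z) (Ici 0) z :=
        fun z _ => ((hasDerivAt_front 1 z).sub_const 1).hasDerivWithinAt
      rw [hnorm_congr (g := fun z => z ^ m * (p.eval z * Real.exp (-z ^ 2 / 4))) fun z hz => by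
        simp only [hderiv_succ_of_hasDerivWithinAt h1 k hz, hp' z hz]]
      have hc : Continuous fun z => z ^ m * (p.eval z * Real.exp (-z ^ 2 / 4)) :=
        (continuous_pow m).mul (p.continuous.mul (by fun_prop))
      refine hnorm_ne_zero (by simp) hc.aestronglyMeasurable (S := Ioi 0 \ {z | p.IsRoot z}) ?_
        (sdiff_subset.trans Ioi_subset_Ici_self) fun z hz => ?_
      · rw [measure_sdiff_null ((Polynomial.finite_setOfPred_isRoot hp).measure_zero _)]
        simp
      · exact mul_ne_zero (pow_ne_zero m (ne_of_gt hz.1))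
          (mul_ne_zero hz.2 (Real.exp_pos _).ne')
  obtain ⟨C, hC⟩ := exists_le_mul_of_mul_le hn
  refine ⟨C + 2, fun δ σ hδ hσ => ?_⟩
  rw [ENNReal.ofReal_add hδ hσ]
  push_cast
  rw [add_mul]
  refine add_le_add (hC _ _ ?_) ?_
  · rw [← hnorm_const_mul hδ, hnorm_congr (g := fun z => z ^ m * hderiv k
      (fun y => front δ y - δ) z) fun z _ => by
        simp only [hderiv_front_sub δ k z]
        ring]
    exact le_max_right _ _
  · calc ENNReal.ofReal σ = 2 * ENNReal.ofReal (σ / 2) := by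
          rw [show (2 : ℝ≥0∞) = ENNReal.ofReal 2 by simp, ← ENNReal.ofReal_mul (by norm_num)]
          congr 1
          ring
      _ ≤ _ := by
          gcongr
          exact le_max_left _ _

/-! ### Uniqueness, existence and estimates for the boundary value problem -/

/-- With η = 2/100000 for both, the two solutions are fixed pairs with the same bound M. -/
theorem eqOn_of_isCharPair {a P Q : ℝ} {p₁ q₁ f₁ g₁ p₂ q₂ f₂ g₂ : ℝ → ℝ}
    (ha : |a - 1| ≤ 1 / 100000) (hP : |P - a| ≤ 2 / 100000) (hQ : |Q - a| ≤ 2 / 100000)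
    (h₁ : IsCharPair a P Q p₁ q₁ f₁ g₁) (h₂ : IsCharPair a P Q p₂ q₂ f₂ g₂) :
    EqOn p₁ p₂ (Ici 0) ∧ EqOn q₁ q₂ (Ici 0) := by
  have ha' := abs_le.1 ha
  have hP' := abs_le.1 hP
  have hQ' := abs_le.1 hQ
  exact IsFixedPair.eqOn (by norm_num) (by norm_num) ha hP hQ
    (h₁.isFixedPair (fun z hz => h₁.add_pos (by linarith) (by linarith) (by linarith) hz) ha hP hQ
      le_rfl)
    (h₂.isFixedPair (fun z hz => h₂.add_pos (by linarith) (by linarith) (by linarith) hz) ha hP hQ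
      le_rfl)

theorem IsSolution.eqOn {δ σ : ℝ} (hδ : 0 < δ) (hδ' : δ < 1 / 100000) (hσ : 0 ≤ σ)
    (hσ' : σ < 1 / 100000) {φ₁ ψ₁ φ₂ ψ₂ : ℝ → ℝ} (h₁ : IsSolution δ σ φ₁ ψ₁)
    (h₂ : IsSolution δ σ φ₂ ψ₂) : EqOn φ₁ φ₂ (Ici 0) ∧ EqOn ψ₁ ψ₂ (Ici 0) := by
  obtain ⟨hp, hq⟩ := eqOn_of_isCharPair (abs_le.2 ⟨by linarith, by linarith⟩)
    (abs_le.2 ⟨by linarith, by linarith⟩) (abs_le.2 ⟨by linarith, by linarith⟩)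
    h₁.isCharPair h₂.isCharPair
  refine ⟨fun z hz => ?_, fun z hz => ?_⟩
  · have h1 := hp hz
    have h2 := hq hz
    simp only at h1 h2
    linarith
  · have h1 := hp hz
    have h2 := hq hz
    simp only at h1 h2
    linarith

/-- The admissible parameters `(δ, σ)`. -/
abbrev SmallParams : Type :=
  {x : ℝ × ℝ // (0 < x.1 ∧ x.1 < 1 / 100000) ∧ 0 ≤ x.2 ∧ x.2 < 1 / 100000}

/-- Treating all parameters as one family makes the constants uniform. Here η = δ + σ, so that the
fixed pair itself has size δ + σ. -/
theorem exists_family_isSolution : ∃ φ ψ : SmallParams → ℝ → ℝ,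
    (∀ i, IsSolution i.1.1 i.1.2 (φ i) (ψ i)) ∧
    (∀ n, DerivBound (RapidDecay fun i => i.1.1 + i.1.2) n φ) ∧
    ∀ n, DerivBound (RapidDecay fun i => i.1.1 + i.1.2) n ψ := by
  have hex : ∀ i : SmallParams,
      ∃ p q f g, IsFixedPair (8 * (i.1.1 + i.1.2)) (1 - i.1.1) (1 + i.1.2) (1 - i.1.2) p q f g := by
    rintro ⟨⟨δ, σ⟩, ⟨h1, h2⟩, h3, h4⟩
    simp only at h1 h2 h3 h4
    exact exists_isFixedPair (abs_le.2 ⟨by linarith, by linarith⟩)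
      (abs_le.2 ⟨by linarith, by linarith⟩) (abs_le.2 ⟨by linarith, by linarith⟩) (by linarith)
  choose p q f g h using hex
  have hM : ∀ i : SmallParams,
      0 ≤ 8 * (i.1.1 + i.1.2) ∧ 8 * (i.1.1 + i.1.2) ≤ 1 / 1000 ∧
        |1 - i.1.1 - 1| ≤ 1 / 100000 := by
    rintro ⟨⟨δ, σ⟩, ⟨h1, h2⟩, h3, h4⟩
    simp only at h1 h2 h3 h4
    exact ⟨by linarith, by linarith, abs_le.2 ⟨by linarith, by linarith⟩⟩
  have he : ∀ i : SmallParams,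
      0 ≤ i.1.1 + i.1.2 := fun i => add_nonneg i.2.1.1.le i.2.2.1
  have hn := fun i => (h i).nearOne (hM i).1 (hM i).2.1 (hM i).2.2
  have hc := fun i => (h i).isCharPair (hM i).1 (hM i).2.1 (hM i).2.2
  have hn' := fun i => (h i).swap.nearOne (hM i).1 (hM i).2.1 (hM i).2.2
  have hc' := fun i => (hc i).swap
  have hb : ∀ {k : SmallParams →
      ℝ → ℝ}, (∀ i z, 0 ≤ z → |k i z| ≤ 8 * (i.1.1 + i.1.2) * weight z) →
      RapidDecay (fun i => i.1.1 + i.1.2) k ∧ PolyBdd k := fun hk =>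
    ⟨rapidDecay_of_abs_le_weight (by norm_num) he hk, polyBdd_of_abs_le (K := 1) fun i z hz =>
      (hk i z hz).trans ((mul_le_of_le_one_right (hM i).1 (weight_le_one z)).trans
        (by linarith [(hM i).2.1]))⟩
  obtain ⟨rf, bf⟩ := hb fun i => (h i).bound_fst
  obtain ⟨rg, bg⟩ := hb fun i => (h i).bound_snd
  have Df := derivBound_rapid_of_isCharPair hc hn bf bg rf
  have Dg := derivBound_rapid_of_isCharPair hc' hn' bg bf rg
  have Dδ := derivBound_frontDeriv (c := fun i : SmallParams => i.1.1)
    (e := fun i => i.1.1 + i.1.2) fun i => by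
    rw [abs_of_pos i.2.1.1]
    linarith [i.2.2.1]
  have Dσ := derivBound_frontDeriv (c := fun i : SmallParams => i.1.2)
    (e := fun i => i.1.1 + i.1.2) fun i => by
    rw [abs_of_nonneg i.2.2.1]
    linarith [i.2.1.1]
  have hsol := fun i => (hc i).isSolution fun z => (hn i).add_pos
  -- The bounds are known for p' and q'; those for φ and ψ follow by integrating from infinity,
  -- where both vanish.
  have lift : ∀ {χ χ' : SmallParams → ℝ → ℝ},
      (∀ i z, 0 ≤ z → HasDerivWithinAt (χ i) (χ' i z) (Ici 0) z) →
      (∀ i, Tendsto (χ i) atTop (𝓝 0)) →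
      (∀ n, DerivBound (RapidDecay fun i => i.1.1 + i.1.2) n χ') →
      ∀ n, DerivBound (RapidDecay fun i => i.1.1 + i.1.2) n χ := fun {χ χ'} hd hl hχ n =>
    DerivBound.of_succ ⟨rapidDecay_of_deriv hd hl (hχ 0), χ', hd, hχ n⟩
  refine ⟨_, _, hsol, ?_, ?_⟩
  · refine lift (χ' := fun i z => 1 / 2 * (f i z + g i z) + -1 * frontDeriv i.1.1 z)
      (fun i z hz => ?_) (fun i => (hsol i).infty_fst) fun n =>
      ((DerivBound.const n (1 / 2)).mul_rapid ((Df n).add RapidDecay.add (Dg n))).add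
        RapidDecay.add ((DerivBound.const n (-1)).mul_rapid (Dδ n))
    exact (((((hc i).deriv_fst z hz).add ((hc i).deriv_snd z hz)).div_const 2).sub_const _ |>.sub
      (hasDerivAt_front _ z).hasDerivWithinAt).congr_deriv (by ring)
  · refine lift (χ' := fun i z => 1 / 2 * (f i z + -1 * g i z) + -1 * frontDeriv i.1.2 z)
      (fun i z hz => ?_) (fun i => (hsol i).infty_snd) fun n =>
      ((DerivBound.const n (1 / 2)).mul_rapid ((Df n).add RapidDecay.add
        ((DerivBound.const n (-1)).mul_rapid (Dg n)))).add
        RapidDecay.add ((DerivBound.const n (-1)).mul_rapid (Dσ n))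
    exact (((((hc i).deriv_fst z hz).sub ((hc i).deriv_snd z hz)).div_const 2).sub
      (hasDerivAt_front _ z).hasDerivWithinAt).congr_deriv (by ring)

end SelfSimilarProfile

theorem mainTheorem4 :
    ∃ ε : ℝ, 0 < ε ∧ ∃ C : ℝ≥0, ∃ K : ℕ → ℕ → ℝ≥0,
      ∀ δ σ : ℝ, 0 < δ → δ < ε → 0 ≤ σ → σ < ε →
        ∃ φ ψ : ℝ → ℝ,
          SelfSimilarProfile.IsSolution δ σ φ ψ ∧
          (∀ φ₁ ψ₁ : ℝ → ℝ, SelfSimilarProfile.IsSolution δ σ φ₁ ψ₁ →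
            EqOn φ₁ φ (Ici 0) ∧ EqOn ψ₁ ψ (Ici 0)) ∧
          (∀ l : ℕ, SelfSimilarProfile.hwNorm φ ψ ≤ C * SelfSimilarProfile.frontSize l δ σ) ∧
          (∀ k : ℕ, ContDiffOn ℝ k φ (Ici 0) ∧ ContDiffOn ℝ k ψ (Ici 0)) ∧
          (∀ m k : ℕ,
            SelfSimilarProfile.sobolevNorm k (fun z => z ^ m * φ z) (fun z => z ^ m * ψ z)
              ≤ K m k * SelfSimilarProfile.frontSizeAt m k δ σ) := by
  obtain ⟨φ, ψ, hsol, hφ, hψ⟩ := SelfSimilarProfile.exists_family_isSolution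
  have he : ∀ i : SelfSimilarProfile.SmallParams,
      0 ≤ i.1.1 + i.1.2 := fun i => add_nonneg i.2.1.1.le i.2.2.1
  obtain ⟨A, hA⟩ := SelfSimilarProfile.exists_hwNorm_le he hφ hψ
  obtain ⟨B, hB⟩ := SelfSimilarProfile.exists_le_frontSize
  choose K hK using SelfSimilarProfile.exists_sobolevNorm_le he hφ hψ
  choose L hL using SelfSimilarProfile.exists_le_frontSizeAt
  -- Each constant is a product: the norm is bounded by a multiple of δ + σ, and δ + σ by a multiple
  -- of the front size.
  refine ⟨1 / 100000, by norm_num, A * B, fun m k => K m k * L m k, fun δ σ hδ hδ' hσ hσ' => ?_⟩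
  let i : SelfSimilarProfile.SmallParams :=
    ⟨(δ, σ), ⟨hδ, hδ'⟩, hσ, hσ'⟩
  refine ⟨φ i, ψ i, hsol i, fun φ₁ ψ₁ h₁ => h₁.eqOn hδ hδ' hσ hσ' (hsol i), fun l => ?_,
    fun k => ⟨(hφ (k + 1)).contDiffOn i, (hψ (k + 1)).contDiffOn i⟩, fun m k => ?_⟩
  · refine (hA i).trans ?_
    rw [ENNReal.coe_mul, mul_assoc]
    gcongr
    exact hB l δ σ hδ.le hσ
  · refine (hK m k i).trans ?_
    rw [ENNReal.coe_mul, mul_assoc]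
    gcongr
    exact hL m k δ σ hδ.le hσ
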